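/- Let $n\ge 0$ and let $X=\{X(t)\}_{t\in\mathbb R}$ be an operator Brownian motion in $\mathbb R^n$, that is: - $X$ is a Gaussian process with stationary and independent increments, and $X(0)=0$ almost surely; - $X$ is proper: for every $t\neq 0$ the law of $X(t)$ is not carried by a proper affine subspace of $\mathbb R^n$; - $X$ is operator self-similar: $t\mapsto X(t)$ is continuous in law, and for some real $n\times n$ matrix $H$, $\{X(ct)\}_{t\in\mathbb R}\overset{\mathcal L}{=}\{c^{H}X(t)\}_{t\in\mathbb R}$ for all $c>0$, where $c^H=\exp(\log(c)H)$. Here $\overset{\mathcal L}{=}$ is equality of finite-dimensional distributions. Then there is a (symmetric) positive definite real $n\times n$ matrix $W$ such that $$\{X(t)\}_{t\in\mathbb R}\overset{\mathcal L}{=}\Bigl\{\frac1{\sqrt{2\pi}}\int_{\mathbb R}\frac{e^{itx}-1}{ix}\,W\widetilde B(dx)\Bigr\}_{t\in\mathbb R}\overset{\mathcal L}{=}\{W B(t)\}_{t\in\mathbb R}.$$ Here $B$ is any vector of $n$ independent standard Brownian motions indexed by $\mathbb R$ (in the sense of finite-dimensional distributions: each component vanishes at $0$ almost surely and has independent increments,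 the one from $s$ to $t$ being $N(0,|t-s|)$). Further, $\widetilde B=\widetilde B_1+i\widetilde B_2$ is any $\mathbb C^n$-valued random measure on $\mathbb R$ (defined on Borel sets of finite Lebesgue measure) such that $\widetilde B_1,\widetilde B_2$ are independent, real, centred and Gaussian, $\widetilde B_1(-A)=\widetilde B_1(A)$ and $\widetilde B_2(-A)=-\widetilde B_2(A)$ almost surely, and $E\,\widetilde B(A)\widetilde B(A')^*=|A\cap A'|\,I$. The integral is the $L^2$ limit of the integrals of simple functions. Such $B$ and $\widetilde B$ exist. -/

import Mathlib

open MeasureTheory ProbabilityTheory Filter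
open scoped Topology ENNReal

noncomputable section

namespace OBM

/-- Equality of finite-dimensional distributions of two processes indexed by `ℝ`,
possibly defined on different probability spaces. -/
def EqLaw {Ω Ω' E : Type*} [MeasurableSpace Ω] [MeasurableSpace Ω'] [MeasurableSpace E]
    (X : ℝ → Ω → E) (P : Measure Ω) (Y : ℝ → Ω' → E) (Q : Measure Ω') : Prop :=
  ∀ I : Finset ℝ,
    IdentDistrib (fun ω => I.restrict (fun t => X t ω)) (fun ω => I.restrict (fun t => Y t ω)) P Q

/-- The matrix power `c ^ H = exp (log c • H)`, for `c > 0`. -/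
def matPow {n : ℕ} (c : ℝ) (H : Matrix (Fin n) (Fin n) ℝ) : Matrix (Fin n) (Fin n) ℝ :=
  NormedSpace.exp (Real.log c • H)

/-- A process in `ℝⁿ` is proper if, for every `t ≠ 0`, the law of `X t` is not carried by a
proper affine subspace. -/
def IsProper {n : ℕ} {Ω : Type*} [MeasurableSpace Ω]
    (X : ℝ → Ω → Fin n → ℝ) (P : Measure Ω) : Prop :=
  ∀ t : ℝ, t ≠ 0 → ∀ S : AffineSubspace ℝ (Fin n → ℝ), (∀ᵐ ω ∂P, X t ω ∈ S) → S = ⊤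

/-- The increments `X (t + h) - X h`, as a process in `t`, have a law that does not depend
on `h`. -/
def HasStationaryIncrements {n : ℕ} {Ω : Type*} [MeasurableSpace Ω]
    (X : ℝ → Ω → Fin n → ℝ) (P : Measure Ω) : Prop :=
  ∀ h h' : ℝ, EqLaw (fun t ω => X (t + h) ω - X h ω) P (fun t ω => X (t + h') ω - X h' ω) P

/-- Operator self-similar processes: proper, continuous in law, and
`{X (c t)} = {c ^ H X t}` in law for all `c > 0`, for some matrix `H`. -/
structure IsOperatorSelfSimilar {n : ℕ} {Ω : Type*} [MeasurableSpace Ω]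
    (X : ℝ → Ω → Fin n → ℝ) (P : Measure Ω) [IsProbabilityMeasure P] : Prop where
  proper : IsProper X P
  continuous_in_law : ∀ t : ℝ, TendstoInDistribution X (𝓝 t) (X t) (fun _ => P) P
  scaling : ∃ H : Matrix (Fin n) (Fin n) ℝ, ∀ c : ℝ, 0 < c →
    EqLaw (fun t ω => X (c * t) ω) P (fun t ω => (matPow c H).mulVec (X t ω)) P

/-- Operator Brownian motions in `ℝⁿ`, indexed by `ℝ`. -/
structure IsOperatorBrownianMotion {n : ℕ} {Ω : Type*} [MeasurableSpace Ω]
    (X : ℝ → Ω → Fin n → ℝ) (P : Measure Ω) [IsProbabilityMeasure P] : Prop where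
  gaussian : IsGaussianProcess X P
  oss : IsOperatorSelfSimilar X P
  stationary_increments : HasStationaryIncrements X P
  indep_increments : HasIndepIncrements X P
  zero : ∀ᵐ ω ∂P, X 0 ω = 0

/-- A real standard Brownian motion indexed by `ℝ`, in the sense of finite-dimensional
distributions. Continuity of paths is not required: only equality of
finite-dimensional distributions is considered, and what holds for every such process holds in
particular for every one with continuous paths. -/
structure IsStandardBM {Ω : Type*} [MeasurableSpace Ω]
    (b : ℝ → Ω → ℝ) (Q : Measure Ω) : Prop where
  zero : ∀ᵐ ω ∂Q, b 0 ω = 0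
  indep_increments : HasIndepIncrements b Q
  law_increment : ∀ s t : ℝ,
    HasLaw (fun ω => b t ω - b s ω) (gaussianReal 0 (Real.nnabs (t - s))) Q

/-- A vector of independent standard Brownian motions. -/
structure IsStandardBMVector {n : ℕ} {Ω : Type*} [MeasurableSpace Ω]
    (B : ℝ → Ω → Fin n → ℝ) (Q : Measure Ω) : Prop where
  component : ∀ i : Fin n, IsStandardBM (fun t ω => B t ω i) Q
  indep : iIndepFun (fun (i : Fin n) (ω : Ω) (t : ℝ) => B t ω i) Q

/-- Borel subsets of `ℝ` of finite Lebesgue measure. -/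
abbrev FinBorel : Type := {A : Set ℝ // MeasurableSet A ∧ volume A < ∞}

/-- The random measure `B̃(dx) = B̃₁(dx) + i B̃₂(dx)` on `ℝ` with values in `ℂⁿ`: `B̃₁`, `B̃₂` are
independent real centred Gaussian random measures, `B̃₁(-dx) = B̃₁(dx)`, `B̃₂(-dx) = -B̃₂(dx)` and
`E B̃(dx) B̃(dx)* = dx` (times the identity matrix). Values on sets which are not Borel or not of
finite Lebesgue measure are irrelevant. Countable additivity in `L²` follows from the covariance. -/
structure IsHermitianGaussianMeasure {n : ℕ} {Ω : Type*} [MeasurableSpace Ω]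
    (Z : Set ℝ → Ω → Fin n → ℂ) (Q : Measure Ω) : Prop where
  gaussian_re : IsGaussianProcess (fun (A : FinBorel) ω (i : Fin n) => (Z A ω i).re) Q
  gaussian_im : IsGaussianProcess (fun (A : FinBorel) ω (i : Fin n) => (Z A ω i).im) Q
  indep : IndepFun (fun ω (A : FinBorel) (i : Fin n) => (Z A ω i).re)
    (fun ω (A : FinBorel) (i : Fin n) => (Z A ω i).im) Q
  centered : ∀ (A : FinBorel) (i : Fin n), ∫ ω, Z A ω i ∂Q = 0
  cov : ∀ (A A' : FinBorel) (i j : Fin n),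
    ∫ ω, Z A ω i * (starRingEnd ℂ) (Z A' ω j) ∂Q =
      if i = j then ((volume.real ((A : Set ℝ) ∩ A') : ℝ) : ℂ) else 0
  symm_re : ∀ A : FinBorel, ∀ᵐ ω ∂Q, ∀ i : Fin n,
    (Z ((fun x : ℝ => -x) ⁻¹' A) ω i).re = (Z A ω i).re
  symm_im : ∀ A : FinBorel, ∀ᵐ ω ∂Q, ∀ i : Fin n,
    (Z ((fun x : ℝ => -x) ⁻¹' A) ω i).im = -(Z A ω i).im

/-- The linear transform `W Z` of a vector random measure by a real matrix `W`. -/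
def matMeasure {n : ℕ} {Ω : Type*} (W : Matrix (Fin n) (Fin n) ℝ)
    (Z : Set ℝ → Ω → Fin n → ℂ) : Set ℝ → Ω → Fin n → ℂ :=
  fun A ω => (W.map (fun a : ℝ => (a : ℂ))).mulVec (Z A ω)

/-- The integral of a simple function with respect to a vector random measure. -/
def simpleIntegral {n : ℕ} {Ω : Type*} (Z : Set ℝ → Ω → Fin n → ℂ) (s : SimpleFunc ℝ ℂ) :
    Ω → Fin n → ℂ :=
  fun ω => ∑ a ∈ s.range, a • Z (s ⁻¹' {a}) ω

/-- `Y` is (a version of) the Wiener integral `∫ f dZ`: the limit in `L²(Q)` of the integrals of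
simple functions, of finite measure support, that converge to `f` in `L²(dx)`. -/
def IsWienerIntegral {n : ℕ} {Ω : Type*} [MeasurableSpace Ω] (Z : Set ℝ → Ω → Fin n → ℂ)
    (Q : Measure Ω) (f : ℝ → ℂ) (Y : Ω → Fin n → ℂ) : Prop :=
  MemLp f 2 volume ∧ MemLp Y 2 Q ∧
    ∃ s : ℕ → SimpleFunc ℝ ℂ, (∀ k, (s k).FinMeasSupp volume) ∧
      Tendsto (fun k => eLpNorm (fun x => s k x - f x) 2 volume) atTop (𝓝 0) ∧
      Tendsto (fun k => eLpNorm (fun ω => simpleIntegral Z (s k) ω - Y ω) 2 Q) atTop (𝓝 0)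

open Classical in
/-- The Wiener integral `∫ f dZ` (determined up to a null set when it exists). -/
def wienerIntegral {n : ℕ} {Ω : Type*} [MeasurableSpace Ω] (Z : Set ℝ → Ω → Fin n → ℂ)
    (Q : Measure Ω) (f : ℝ → ℂ) : Ω → Fin n → ℂ :=
  if h : ∃ Y, IsWienerIntegral Z Q f Y then h.choose else 0

/-- The kernel `x ↦ (exp (i t x) - 1) / (i x)`. -/
def kernel (t : ℝ) (x : ℝ) : ℂ :=
  (Complex.exp (Complex.I * t * x) - 1) / (Complex.I * x)

end OBM

end

/-! All three processes are centred and Gaussian, and a Gaussian process is determined in law by its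
means and covariances (`IsGaussianProcess.identDistrib`). Everything reduces to computing these.

For `X`, let `Γ` be the covariance matrix of `X 1`. Independent stationary increments make the
covariance matrix of `X a` additive in `a ≥ 0`; variances are nonnegative, so additivity forces
linearity, and polarization extends this to cross-covariances. Together with `X 0 = 0` this gives
`Cov (X s, X t) = bmCov s t • Γ` for all real times (`covariance_eval`). Properness makes `Γ`
positive definite (`covMat_posDef`), and `W` is its positive definite square root, so that `W * Wᵀ =
Γ`.

The mean `m` of `X t` is additive in `t`, and self-similarity has to exclude a drift
(`integral_eval`). With `A = 2 ^ H`, scaling gives `A m = 2 m` and `A Γ Aᵀ = 2 Γ`. Put `w = Γ⁻¹ m`.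
Then `A Γ Aᵀ w = 2 m = A Γ w`, hence `Aᵀ w = w`, so `w ⬝ m = Aᵀ w ⬝ m = w ⬝ A m = 2 (w ⬝ m)`. Thus
`mᵀ Γ⁻¹ m = 0` and `m = 0`.

For the spectral integral, two bilinear identities pass from sets to simple functions and then to
`L²` limits: `E Y V* = Γ ∫ f(x) conj (g x) dx` and `E Y Vᵀ = Γ ∫ f(x) g(-x) dx`. For a Hermitian
kernel they agree when `Y = V`, so the integral is almost surely real. Its covariance comes from `∫
(1 - cos (t x)) / x² dx = π |t|`, whence `Re ∫ kernel s * conj (kernel t) = 2 π bmCov s t`.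
Gaussianity survives `L²` limits (`HasGaussianLaw.of_tendsto_eLpNorm`).

Existence of `B` and of the Hermitian measure follows from a Gaussian white noise, built by mapping
a Hilbert basis isometrically onto independent `N(0,1)` variables in `L²(Q)`. -/

/-! ### Moments along `L²` convergent sequences. -/

section L2Limits

variable {α 𝕜 : Type*} [MeasurableSpace α] {μ : Measure α} [RCLike 𝕜]

/-- The integral of a product is jointly continuous along `L²` convergent sequences. -/
theorem tendsto_integral_mul_of_tendsto_eLpNorm {F G : ℕ → α → 𝕜} {f g : α → 𝕜}
    (hF : ∀ k, MemLp (F k) 2 μ) (hf : MemLp f 2 μ) (hG : ∀ k, MemLp (G k) 2 μ) (hg : MemLp g 2 μ)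
    (hFf : Tendsto (fun k => eLpNorm (F k - f) 2 μ) atTop (𝓝 0))
    (hGg : Tendsto (fun k => eLpNorm (G k - g) 2 μ) atTop (𝓝 0)) :
    Tendsto (fun k => ∫ x, F k x * G k x ∂μ) atTop (𝓝 (∫ x, f x * g x ∂μ)) := by
  -- The inner product is conjugate-linear in its first slot, so a bilinear integral is an inner
  -- product against `star u`.
  have key : ∀ {u v : α → 𝕜} (hu : MemLp u 2 μ) (hv : MemLp v 2 μ),
      ∫ x, u x * v x ∂μ = inner 𝕜 (hu.star.toLp (star u)) (hv.toLp v) := by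
    intro u v hu hv
    rw [L2.inner_def]
    refine integral_congr_ae ?_
    filter_upwards [hu.star.coeFn_toLp, hv.coeFn_toLp] with x h1 h2
    simp [h1, h2, mul_comm]
  rw [key hf hg]
  simp_rw [fun k => key (hF k) (hG k)]
  refine Tendsto.inner ?_ ?_
  · refine (Lp.tendsto_Lp_iff_tendsto_eLpNorm'' _ (fun k => (hF k).star) _ hf.star).2 ?_
    refine hFf.congr fun k => ?_
    refine eLpNorm_congr_norm_ae (ae_of_all _ fun x => ?_)
    simp only [Pi.sub_apply, Pi.star_apply, ← star_sub, norm_star]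
  · exact (Lp.tendsto_Lp_iff_tendsto_eLpNorm'' _ hG _ hg).2 hGg

theorem tendsto_integral_of_tendsto_eLpNorm_two [IsFiniteMeasure μ] {F : ℕ → α → 𝕜} {f : α → 𝕜}
    (hF : ∀ k, MemLp (F k) 2 μ) (hf : MemLp f 2 μ)
    (hFf : Tendsto (fun k => eLpNorm (F k - f) 2 μ) atTop (𝓝 0)) :
    Tendsto (fun k => ∫ x, F k x ∂μ) atTop (𝓝 (∫ x, f x ∂μ)) := by
  have := tendsto_integral_mul_of_tendsto_eLpNorm (G := fun _ _ => (1 : 𝕜)) (g := fun _ => 1)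
    hF hf (fun _ => memLp_const 1) (memLp_const 1) hFf (by simp)
  simpa using this

end L2Limits

/-! ### Gaussian processes: `L²` limits and determination by covariance. -/

theorem StrongDual.exists_eq_sum_mul {ι : Type*} [Fintype ι] (L : StrongDual ℝ (ι → ℝ)) :
    ∃ c : ι → ℝ, ∀ x, L x = ∑ i, c i * x i := by
  classical
  refine ⟨fun i => L (Pi.single i 1), fun x => ?_⟩
  conv_lhs => rw [pi_eq_sum_univ' x, map_sum]
  refine Finset.sum_congr rfl fun i _ => ?_
  rw [map_smul, smul_eq_mul, mul_comm]

namespace ProbabilityTheory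

variable {Ω Ω' T : Type*} [MeasurableSpace Ω] [MeasurableSpace Ω'] {P : Measure Ω} {Q : Measure Ω'}

/-- Means and variances converge, so the Gaussian characteristic functions of `Y k` converge to the
Gaussian one with the mean and variance of `Z`. They also converge to the characteristic function of
`Z`, because `|exp (i a) - exp (i b)| ≤ |a - b|` and `L²` convergence implies `L¹` convergence. The
two limits coincide. -/
theorem HasGaussianLaw.of_tendsto_eLpNorm [IsProbabilityMeasure P] {Y : ℕ → Ω → ℝ} {Z : Ω → ℝ}
    (hY : ∀ k, HasGaussianLaw (Y k) P) (hZ : MemLp Z 2 P)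
    (h : Tendsto (fun k => eLpNorm (Y k - Z) 2 P) atTop (𝓝 0)) : HasGaussianLaw Z P := by
  have hY2 : ∀ k, MemLp (Y k) 2 P := fun k => (hY k).memLp_two
  rw [hasGaussianLaw_iff_charFun_map_eq hZ.aemeasurable]
  intro t
  have hmean := tendsto_integral_of_tendsto_eLpNorm_two hY2 hZ h
  have hsq := tendsto_integral_mul_of_tendsto_eLpNorm hY2 hZ hY2 hZ h h
  have hvar : Tendsto (fun k => Var[Y k; P]) atTop (𝓝 Var[Z; P]) := by
    simp_rw [fun k => variance_eq_sub (hY2 k)]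
    rw [variance_eq_sub hZ]
    simpa [pow_two] using hsq.sub (hmean.mul hmean)
  have hR : Tendsto (fun k => charFun (P.map (Y k)) t) atTop
      (𝓝 (Complex.exp ((P[fun ω => inner ℝ t (Z ω)] : ℝ) * Complex.I -
        Var[fun ω => inner ℝ t (Z ω); P] / 2))) := by
    simp_rw [fun k => (hY k).charFun_map_eq t]
    have e : ∀ U : Ω → ℝ, (fun ω => inner ℝ t (U ω)) = fun ω => t * U ω := by
      intro U; ext ω; simp [mul_comm]
    simp_rw [e, integral_const_mul, variance_const_mul]
    refine (Complex.continuous_exp.tendsto _).comp ?_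
    refine Tendsto.sub (Tendsto.mul ?_ tendsto_const_nhds) (Tendsto.div_const ?_ _)
    · exact (Complex.continuous_ofReal.tendsto _).comp (hmean.const_mul t)
    · exact (Complex.continuous_ofReal.tendsto _).comp (hvar.const_mul (t ^ 2))
  refine tendsto_nhds_unique ?_ hR
  have ecf : ∀ U : Ω → ℝ, MemLp U 2 P → charFun (P.map U) t
      = ∫ ω, Complex.exp (Complex.I * ((t * U ω : ℝ) : ℂ)) ∂P := by
    intro U hU
    rw [charFun_apply_real, integral_map hU.aemeasurable (by fun_prop)]
    congr with ω
    push_cast; ring_nf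
  rw [ecf Z hZ]
  simp_rw [fun k => ecf (Y k) (hY2 k)]
  have hint : ∀ U : Ω → ℝ, MemLp U 2 P →
      Integrable (fun ω => Complex.exp (Complex.I * ((t * U ω : ℝ) : ℂ))) P := by
    intro U hU
    refine Integrable.mono' (integrable_const (1 : ℝ)) ?_ (ae_of_all _ fun ω => ?_)
    · have := hU.aestronglyMeasurable
      fun_prop
    · rw [mul_comm, Complex.norm_exp_ofReal_mul_I]
  rw [tendsto_iff_norm_sub_tendsto_zero]
  have hL1 : Tendsto (fun k => |t| * (eLpNorm (Y k - Z) 1 P).toReal) atTop (𝓝 0) := by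
    have h1 : Tendsto (fun k => eLpNorm (Y k - Z) 1 P) atTop (𝓝 0) := by
      refine tendsto_of_tendsto_of_tendsto_of_le_of_le tendsto_const_nhds h
        (fun _ => zero_le) fun k => ?_
      exact eLpNorm_le_eLpNorm_of_exponent_le (by norm_num)
        ((hY2 k).sub hZ).aestronglyMeasurable
    have := (ENNReal.tendsto_toReal ENNReal.zero_ne_top).comp h1
    simpa using this.const_mul |t|
  refine squeeze_zero (fun _ => norm_nonneg _) (fun k => ?_) hL1
  rw [← integral_sub (hint _ (hY2 k)) (hint _ hZ)]
  have hd : Integrable (Y k - Z) P := ((hY2 k).sub hZ).integrable (by norm_num)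
  calc _ ≤ ∫ ω, |t| * ‖(Y k - Z) ω‖ ∂P := by
        refine norm_integral_le_of_norm_le (hd.norm.const_mul _) (ae_of_all _ fun ω => ?_)
        have h1 : Complex.exp (Complex.I * ((t * Y k ω : ℝ) : ℂ))
            - Complex.exp (Complex.I * ((t * Z ω : ℝ) : ℂ))
            = Complex.exp (Complex.I * ((t * Z ω : ℝ) : ℂ)) *
              (Complex.exp (Complex.I * ((t * (Y k ω - Z ω) : ℝ) : ℂ)) - 1) := by
          rw [mul_sub, ← Complex.exp_add, mul_one]
          congr 2
          push_cast; ring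
        rw [h1, norm_mul, mul_comm Complex.I ((t * Z ω : ℝ) : ℂ),
          Complex.norm_exp_ofReal_mul_I, one_mul]
        refine (Real.norm_exp_I_mul_ofReal_sub_one_le).trans ?_
        simp
    _ = _ := by
        rw [integral_const_mul]
        congr 1
        rw [eLpNorm_one_eq_lintegral_enorm, integral_norm_eq_lintegral_enorm hd.1]

/-- By Cramér–Wold it suffices to treat linear functionals of finitely many coordinates; these are
`L²` limits of Gaussian variables. -/
theorem IsGaussianProcess.of_tendsto_eLpNorm [IsProbabilityMeasure P] {Y : ℕ → T → Ω → ℝ}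
    {Z : T → Ω → ℝ} (hY : ∀ k, IsGaussianProcess (Y k) P) (hZ : ∀ t, MemLp (Z t) 2 P)
    (h : ∀ t, Tendsto (fun k => eLpNorm (Y k t - Z t) 2 P) atTop (𝓝 0)) :
    IsGaussianProcess Z P where
  hasGaussianLaw I := by
    have hm : AEMeasurable (fun ω => I.restrict (fun t => Z t ω)) P :=
      aemeasurable_pi_lambda _ fun t => (hZ t).aemeasurable
    rw [hasGaussianLaw_iff_charFunDual_map_eq hm]
    intro L
    obtain ⟨c, hL⟩ := StrongDual.exists_eq_sum_mul L
    have hG : HasGaussianLaw (fun ω => L (I.restrict (fun t => Z t ω))) P := by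
      refine HasGaussianLaw.of_tendsto_eLpNorm
        (Y := fun k ω => L (I.restrict (fun t => Y k t ω))) (fun k => ?_) ?_ ?_
      · exact ((hY k).hasGaussianLaw I).map_fun L
      · simp_rw [hL]
        exact memLp_finsetSum _ fun i _ => (hZ i).const_mul _
      · have hb : Tendsto (fun k => ∑ i : I, ‖c i‖ₑ *
            eLpNorm (Y k i - Z i) 2 P) atTop (𝓝 0) := by
          have : Tendsto (fun k => ∑ i : I, ‖c i‖ₑ *
            eLpNorm (Y k i - Z i) 2 P) atTop (𝓝 (∑ i : I, ‖c i‖ₑ * 0)) :=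
            tendsto_finsetSum _ fun i _ =>
              ENNReal.Tendsto.const_mul (h i) (Or.inr (by simp))
          simpa using this
        refine tendsto_of_tendsto_of_tendsto_of_le_of_le tendsto_const_nhds hb
          (fun _ => zero_le) fun k => ?_
        have e : ((fun ω => L (I.restrict (fun t => Y k t ω))) -
            fun ω => L (I.restrict (fun t => Z t ω))) =
            ∑ i : I, c i • (Y k i - Z i) := by
          ext ω
          simp only [Pi.sub_apply, hL, Finset.sum_apply, Pi.smul_apply, smul_eq_mul,
            ← Finset.sum_sub_distrib, Finset.restrict, mul_sub]
        rw [e]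
        refine (eLpNorm_sum_le (fun i _ => ?_) (by norm_num)).trans ?_
        · exact ((((hY k).hasGaussianLaw_eval i).memLp_two.sub (hZ i)).const_smul
            _).aestronglyMeasurable
        · exact Finset.sum_le_sum fun i _ => eLpNorm_const_smul_le
    rw [charFunDual_apply, integral_map hm (by fun_prop)]
    have := hG.charFun_map_eq 1
    rw [charFun_apply_real, integral_map hG.aemeasurable (by fun_prop)] at this
    simpa [Function.comp_def] using this

/-- Gaussian processes with the same means and covariances have the same finite-dimensional
distributions. -/
theorem IsGaussianProcess.identDistrib {X : T → Ω → ℝ} {Y : T → Ω' → ℝ}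
    (hX : IsGaussianProcess X P) (hY : IsGaussianProcess Y Q)
    (hm : ∀ t, ∫ ω, X t ω ∂P = ∫ ω, Y t ω ∂Q)
    (hc : ∀ s t, cov[X s, X t; P] = cov[Y s, Y t; Q]) (I : Finset T) :
    IdentDistrib (fun ω => I.restrict (fun t => X t ω)) (fun ω => I.restrict (fun t => Y t ω))
      P Q where
  aemeasurable_fst := aemeasurable_pi_lambda _ fun t => hX.aemeasurable t
  aemeasurable_snd := aemeasurable_pi_lambda _ fun t => hY.aemeasurable t
  map_eq := by
    have hP := hX.isProbabilityMeasure
    have hQ := hY.isProbabilityMeasure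
    have := (hX.hasGaussianLaw I).isGaussian_map
    have := (hY.hasGaussianLaw I).isGaussian_map
    apply Measure.ext_of_charFunDual
    ext L
    obtain ⟨c, hL⟩ := StrongDual.exists_eq_sum_mul L
    rw [(hX.hasGaussianLaw I).charFunDual_map_eq_fun, (hY.hasGaussianLaw I).charFunDual_map_eq_fun]
    have hX2 : ∀ t, MemLp (X t) 2 P := fun t => (hX.hasGaussianLaw_eval t).memLp_two
    have hY2 : ∀ t, MemLp (Y t) 2 Q := fun t => (hY.hasGaussianLaw_eval t).memLp_two
    have e1 : ∫ ω, L (I.restrict (fun t => X t ω)) ∂P = ∫ ω, L (I.restrict (fun t => Y t ω)) ∂Q := by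
      simp_rw [hL]
      rw [integral_finsetSum, integral_finsetSum]
      · simp_rw [Finset.restrict, integral_const_mul, hm]
      · exact fun i _ => ((hY2 i).integrable (by norm_num)).const_mul _
      · exact fun i _ => ((hX2 i).integrable (by norm_num)).const_mul _
    have e2 : Var[fun ω => L (I.restrict (fun t => X t ω)); P]
        = Var[fun ω => L (I.restrict (fun t => Y t ω)); Q] := by
      simp_rw [hL, Finset.restrict]
      rw [variance_fun_sum (X := fun (i : I) ω => c i * X i ω) fun i => (hX2 i).const_mul _,
        variance_fun_sum (X := fun (i : I) ω => c i * Y i ω) fun i => (hY2 i).const_mul _]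
      simp_rw [covariance_const_mul_left, covariance_const_mul_right]
      simp_rw [← hc]
    rw [e1, e2]

end ProbabilityTheory

/-! ### Additive functions and the covariance of processes with uncorrelated increments. -/

/-- Nonnegativity makes an additive function monotone. Enclosing `N * a` between consecutive
integers then bounds `N * |f a - a * f 1|` by `f 1` for every `N`. -/
theorem eq_mul_of_additive_of_nonneg {f : ℝ → ℝ} (hf : ∀ a b, 0 ≤ a → 0 ≤ b → f (a + b) = f a + f b)
    (h0 : ∀ a, 0 ≤ a → 0 ≤ f a) {a : ℝ} (ha : 0 ≤ a) : f a = a * f 1 := by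
  have hz : f 0 = 0 := by simpa using hf 0 0 le_rfl le_rfl
  have hn : ∀ (N : ℕ) (b : ℝ), 0 ≤ b → f (N * b) = N * f b := by
    intro N b hb
    induction N with
    | zero => simp [hz]
    | succ N ih =>
      push_cast
      rw [add_mul, one_mul, hf _ _ (by positivity) hb, ih]
      ring
  have hmono : ∀ b c, 0 ≤ b → b ≤ c → f b ≤ f c := by
    intro b c hb hbc
    have := hf b (c - b) hb (by linarith)
    rw [add_sub_cancel] at this
    linarith [h0 (c - b) (by linarith)]
  have hbound : ∀ N : ℕ, N * |f a - a * f 1| ≤ f 1 := by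
    intro N
    have hfl := Nat.floor_le (show 0 ≤ N * a by positivity)
    have hlt := (Nat.lt_floor_add_one (N * a)).le
    have h1 := hmono _ _ (by positivity) hfl
    have h2 := hmono _ _ (by positivity) hlt
    have e1 := hn ⌊N * a⌋₊ 1 zero_le_one
    have e2 := hn (⌊N * a⌋₊ + 1) 1 zero_le_one
    push_cast at e2
    rw [mul_one] at e1 e2
    rw [hn N a ha] at h1 h2
    rw [e1] at h1
    rw [e2] at h2
    have hp := h0 1 zero_le_one
    rw [← Nat.abs_cast N, ← abs_mul, abs_le]
    constructor <;> nlinarith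
  by_contra hne
  have hpos : 0 < |f a - a * f 1| := abs_pos.2 (sub_ne_zero.2 hne)
  obtain ⟨N, hN⟩ := exists_nat_gt (f 1 / |f a - a * f 1|)
  rw [div_lt_iff₀ hpos] at hN
  linarith [hbound N]

namespace OBM

variable {Ω Ω' T : Type*} [MeasurableSpace Ω] [MeasurableSpace Ω'] {P : Measure Ω} {Q : Measure Ω'}
  {n : ℕ}

/-- The covariance function of two-sided Brownian motion. -/
noncomputable def bmCov (s t : ℝ) : ℝ := (|s| + |t| - |t - s|) / 2

theorem bmCov_comm (s t : ℝ) : bmCov s t = bmCov t s := by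
  rw [bmCov, bmCov, abs_sub_comm, add_comm |s|]

theorem isGaussianProcess_coord {X : T → Ω → Fin n → ℝ} (hX : IsGaussianProcess X P) :
    IsGaussianProcess (fun (p : T × Fin n) ω => X p.1 ω p.2) P :=
  hX.of_isGaussianProcess fun p =>
    ⟨{p.1}, (ContinuousLinearMap.proj (R := ℝ) (φ := fun _ : Fin n => ℝ) p.2).comp
      (ContinuousLinearMap.proj (R := ℝ) (φ := fun _ : ({p.1} : Finset T) => Fin n → ℝ)
        ⟨p.1, by simp⟩), fun _ => rfl⟩

theorem isGaussianProcess_of_coord {X : T → Ω → Fin n → ℝ}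
    (hX : IsGaussianProcess (fun (p : T × Fin n) ω => X p.1 ω p.2) P) : IsGaussianProcess X P := by
  classical
  exact hX.of_isGaussianProcess fun t =>
    ⟨{t} ×ˢ Finset.univ,
      ContinuousLinearMap.pi fun i => ContinuousLinearMap.proj (R := ℝ)
        (φ := fun _ : ({t} ×ˢ Finset.univ : Finset (T × Fin n)) => ℝ) ⟨(t, i), by simp⟩,
      fun _ => rfl⟩

theorem identDistrib_restrict_of_coord {X : T → Ω → Fin n → ℝ} {Y : T → Ω' → Fin n → ℝ}
    (h : ∀ J : Finset (T × Fin n), IdentDistrib (fun ω => J.restrict (fun p => X p.1 ω p.2))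
      (fun ω => J.restrict (fun p => Y p.1 ω p.2)) P Q) (I : Finset T) :
    IdentDistrib (fun ω => I.restrict (fun t => X t ω)) (fun ω => I.restrict (fun t => Y t ω))
      P Q := by
  have := (h (I ×ˢ Finset.univ)).comp (u := fun (x : (I ×ˢ (Finset.univ : Finset (Fin n)) : Finset _) → ℝ)
    (t : I) (i : Fin n) => x ⟨(t.1, i), by simp⟩) (by fun_prop)
  exact this

/-- Two Gaussian processes in `ℝⁿ` with the same means and covariances have the same
finite-dimensional distributions. -/
theorem eqLaw_of_coord {X : ℝ → Ω → Fin n → ℝ} {Y : ℝ → Ω' → Fin n → ℝ}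
    (hX : IsGaussianProcess (fun (p : ℝ × Fin n) ω => X p.1 ω p.2) P)
    (hY : IsGaussianProcess (fun (p : ℝ × Fin n) ω => Y p.1 ω p.2) Q)
    (hm : ∀ t i, ∫ ω, X t ω i ∂P = ∫ ω, Y t ω i ∂Q)
    (hc : ∀ s t i j, cov[fun ω => X s ω i, fun ω => X t ω j; P]
      = cov[fun ω => Y s ω i, fun ω => Y t ω j; Q]) : EqLaw X P Y Q := fun I =>
  identDistrib_restrict_of_coord
    (hX.identDistrib hY (fun p => hm p.1 p.2) fun p q => hc p.1 q.1 p.2 q.2) I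

theorem EqLaw.identDistrib_eval {E : Type*} [MeasurableSpace E] {X : ℝ → Ω → E} {Y : ℝ → Ω' → E}
    (h : EqLaw X P Y Q) (t : ℝ) : IdentDistrib (X t) (Y t) P Q :=
  (h {t}).comp (u := fun x : ({t} : Finset ℝ) → E => x ⟨t, by simp⟩) (by fun_prop)

section Covariance

variable {U V : ℝ → Ω → ℝ}

theorem covariance_eq_zero_of_ae_eq_zero_left {Y Z : Ω → ℝ} (hY : ∀ᵐ ω ∂P, Y ω = 0) :
    cov[Y, Z; P] = 0 := by
  have h0 : ∫ ω, Y ω ∂P = 0 := integral_eq_zero_of_ae hY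
  refine integral_eq_zero_of_ae ?_
  filter_upwards [hY] with ω hω
  simp [hω, h0]

theorem covariance_eq_zero_of_ae_eq_zero_right {Y Z : Ω → ℝ} (hZ : ∀ᵐ ω ∂P, Z ω = 0) :
    cov[Y, Z; P] = 0 := by
  rw [covariance_comm, covariance_eq_zero_of_ae_eq_zero_left hZ]

/-- Each case uses increments with an endpoint at `0`. For `0 ≤ s ≤ t` the covariance is that of `U
s` and `V s`; for `s ≤ 0 ≤ t` it vanishes; for `s ≤ t ≤ 0` it is that of `U t` and `V t`. -/
theorem covariance_eq_bmCov_mul_of_le [IsProbabilityMeasure P] (hU : ∀ t, MemLp (U t) 2 P) (hV : ∀ t, MemLp (V t) 2 P)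
    (hU0 : ∀ᵐ ω ∂P, U 0 ω = 0) (hV0 : ∀ᵐ ω ∂P, V 0 ω = 0)
    (hUV : ∀ r s t, r ≤ s → s ≤ t →
      cov[fun ω => U s ω - U r ω, fun ω => V t ω - V s ω; P] = 0) {γ : ℝ}
    (hγ : ∀ s t, s ≤ t → cov[fun ω => U t ω - U s ω, fun ω => V t ω - V s ω; P] = (t - s) * γ)
    {s t : ℝ} (hst : s ≤ t) : cov[U s, V t; P] = bmCov s t * γ := by
  have hl : ∀ x, cov[U 0, V x; P] = 0 := fun x => covariance_eq_zero_of_ae_eq_zero_left hU0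
  have hr : ∀ x, cov[U x, V 0; P] = 0 := fun x => covariance_eq_zero_of_ae_eq_zero_right hV0
  simp only [fun a b c d => covariance_fun_sub_fun_sub (hU b) (hU a) (hV d) (hV c)] at hUV hγ
  rw [bmCov, abs_of_nonneg (sub_nonneg.2 hst)]
  rcases le_total 0 s with hs | hs
  · have h1 := hUV 0 s t hs hst
    have h2 := hγ 0 s hs
    rw [hl, hl] at h1 h2
    rw [hr] at h2
    rw [abs_of_nonneg hs, abs_of_nonneg (hs.trans hst)]
    linarith
  · rcases le_total 0 t with ht | ht
    · have h1 := hUV s 0 t hs ht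
      rw [hl, hl, hr] at h1
      rw [abs_of_nonpos hs, abs_of_nonneg ht]
      linarith
    · have h1 := hUV s t 0 hst ht
      have h2 := hγ t 0 ht
      rw [hr, hr] at h1 h2
      rw [hl] at h2
      rw [abs_of_nonpos hs, abs_of_nonpos ht]
      linarith

/-- The covariance of two processes that vanish at `0`, with mutually uncorrelated increments on
successive intervals and `Cov (U t - U s) (V t - V s) = (t - s) γ`. -/
theorem covariance_eq_bmCov_mul [IsProbabilityMeasure P] (hU : ∀ t, MemLp (U t) 2 P) (hV : ∀ t, MemLp (V t) 2 P)
    (hU0 : ∀ᵐ ω ∂P, U 0 ω = 0) (hV0 : ∀ᵐ ω ∂P, V 0 ω = 0)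
    (hUV : ∀ r s t, r ≤ s → s ≤ t →
      cov[fun ω => U s ω - U r ω, fun ω => V t ω - V s ω; P] = 0)
    (hVU : ∀ r s t, r ≤ s → s ≤ t →
      cov[fun ω => V s ω - V r ω, fun ω => U t ω - U s ω; P] = 0) {γ : ℝ}
    (hγ : ∀ s t, s ≤ t → cov[fun ω => U t ω - U s ω, fun ω => V t ω - V s ω; P] = (t - s) * γ)
    (s t : ℝ) : cov[U s, V t; P] = bmCov s t * γ := by
  rcases le_total s t with hst | hst
  · exact covariance_eq_bmCov_mul_of_le hU hV hU0 hV0 hUV hγ hst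
  · rw [covariance_comm, bmCov_comm]
    refine covariance_eq_bmCov_mul_of_le hV hU hV0 hU0 hVU (fun s t hst => ?_) hst
    rw [covariance_comm, hγ s t hst]

end Covariance

end OBM

/-! ### Mean and covariance of an operator Brownian motion. -/

namespace OBM

variable {Ω Ω' : Type*} [MeasurableSpace Ω] [MeasurableSpace Ω'] {P : Measure Ω} {Q : Measure Ω'}
  {n : ℕ}

theorem covariance_eval_eq_of_identDistrib {Y : Ω → Fin n → ℝ} {Z : Ω' → Fin n → ℝ}
    (h : IdentDistrib Y Z P Q) (i j : Fin n) :
    cov[fun ω => Y ω i, fun ω => Y ω j; P] = cov[fun ω => Z ω i, fun ω => Z ω j; Q] := by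
  have e1 := covariance_map_fun (μ := P) (X := fun x : Fin n → ℝ => x i) (Y := fun x => x j)
    (measurable_pi_apply i).aestronglyMeasurable (measurable_pi_apply j).aestronglyMeasurable
    h.aemeasurable_fst
  have e2 := covariance_map_fun (μ := Q) (X := fun x : Fin n → ℝ => x i) (Y := fun x => x j)
    (measurable_pi_apply i).aestronglyMeasurable (measurable_pi_apply j).aestronglyMeasurable
    h.aemeasurable_snd
  rw [← e1, ← e2, h.map_eq]

variable [IsProbabilityMeasure P] {X : ℝ → Ω → Fin n → ℝ}

namespace IsOperatorBrownianMotion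

theorem hasGaussianLaw_eval (hX : IsOperatorBrownianMotion X P) (t : ℝ) :
    HasGaussianLaw (X t) P :=
  hX.gaussian.hasGaussianLaw_eval t

theorem memLp_eval (hX : IsOperatorBrownianMotion X P) (t : ℝ) (i : Fin n) :
    MemLp (fun ω => X t ω i) 2 P :=
  ((hX.hasGaussianLaw_eval t).map_fun
    (ContinuousLinearMap.proj (R := ℝ) (φ := fun _ : Fin n => ℝ) i)).memLp_two

theorem zero_apply (hX : IsOperatorBrownianMotion X P) (i : Fin n) : ∀ᵐ ω ∂P, X 0 ω i = 0 := by
  filter_upwards [hX.zero] with ω hω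
  simp [hω]

theorem covariance_increments_eq_zero (hX : IsOperatorBrownianMotion X P) (i j : Fin n) {r s t : ℝ}
    (hrs : r ≤ s) (hst : s ≤ t) :
    cov[fun ω => X s ω i - X r ω i, fun ω => X t ω j - X s ω j; P] = 0 := by
  have h := (hX.indep_increments.indepFun_sub_sub hrs hst).comp (measurable_pi_apply i)
    (measurable_pi_apply j)
  exact h.covariance_eq_zero ((hX.memLp_eval s i).sub (hX.memLp_eval r i))
    ((hX.memLp_eval t j).sub (hX.memLp_eval s j))

theorem identDistrib_increment (hX : IsOperatorBrownianMotion X P) (s t : ℝ) :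
    IdentDistrib (fun ω => X t ω - X s ω) (X (t - s)) P P := by
  have h := (hX.stationary_increments s 0).identDistrib_eval (t - s)
  simp only [sub_add_cancel, add_zero] at h
  refine h.trans (IdentDistrib.of_ae_eq h.aemeasurable_snd ?_)
  filter_upwards [hX.zero] with ω hω
  simp [hω]

theorem covariance_increment (hX : IsOperatorBrownianMotion X P) (i j : Fin n) (s t : ℝ) :
    cov[fun ω => X t ω i - X s ω i, fun ω => X t ω j - X s ω j; P]
      = cov[fun ω => X (t - s) ω i, fun ω => X (t - s) ω j; P] :=
  covariance_eval_eq_of_identDistrib (hX.identDistrib_increment s t) i j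

/-- `X (a + b)` is the sum of `X a` and an uncorrelated increment that has the law of `X b`. -/
theorem covariance_add (hX : IsOperatorBrownianMotion X P) (i j : Fin n) {a b : ℝ}
    (ha : 0 ≤ a) (hb : 0 ≤ b) :
    cov[fun ω => X (a + b) ω i, fun ω => X (a + b) ω j; P]
      = cov[fun ω => X a ω i, fun ω => X a ω j; P] +
        cov[fun ω => X b ω i, fun ω => X b ω j; P] := by
  have h1 := hX.covariance_increments_eq_zero i j ha (le_add_of_nonneg_right hb)
  have h2 := hX.covariance_increments_eq_zero j i ha (le_add_of_nonneg_right hb)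
  have h3 := hX.covariance_increment i j a (a + b)
  rw [add_sub_cancel_left] at h3
  have hm := hX.memLp_eval
  rw [covariance_fun_sub_fun_sub (hm _ _) (hm _ _) (hm _ _) (hm _ _)] at h1 h2 h3
  rw [covariance_eq_zero_of_ae_eq_zero_left (hX.zero_apply i),
    covariance_eq_zero_of_ae_eq_zero_left (hX.zero_apply i)] at h1
  rw [covariance_eq_zero_of_ae_eq_zero_left (hX.zero_apply j),
    covariance_eq_zero_of_ae_eq_zero_left (hX.zero_apply j),
    covariance_comm, covariance_comm (fun ω => X a ω j)] at h2
  linarith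

/-- The covariance matrix of `X 1`. -/
noncomputable def _root_.OBM.covMat (X : ℝ → Ω → Fin n → ℝ) (P : Measure Ω) :
    Matrix (Fin n) (Fin n) ℝ :=
  Matrix.of fun i j => cov[fun ω => X 1 ω i, fun ω => X 1 ω j; P]

/-- Cross-covariances have no sign, so linearity is proved for the variances of `X i`, `X j` and `X
i + X j`, and then polarized. -/
theorem covariance_eval_self (hX : IsOperatorBrownianMotion X P) (i j : Fin n) {a : ℝ}
    (ha : 0 ≤ a) :
    cov[fun ω => X a ω i, fun ω => X a ω j; P] = a * covMat X P i j := by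
  have hvar : ∀ (k : Fin n) {b : ℝ}, 0 ≤ b → cov[fun ω => X b ω k, fun ω => X b ω k; P]
      = b * cov[fun ω => X 1 ω k, fun ω => X 1 ω k; P] := by
    intro k b hb
    refine eq_mul_of_additive_of_nonneg
      (f := fun b => cov[fun ω => X b ω k, fun ω => X b ω k; P])
      (fun a b ha hb => hX.covariance_add k k ha hb) (fun c _ => ?_) hb
    rw [covariance_self (hX.memLp_eval c k).aemeasurable]
    exact variance_nonneg _ _
  have hm := hX.memLp_eval
  have hexp : ∀ c : ℝ, cov[fun ω => X c ω i + X c ω j, fun ω => X c ω i + X c ω j; P]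
      = cov[fun ω => X c ω i, fun ω => X c ω i; P]
        + 2 * cov[fun ω => X c ω i, fun ω => X c ω j; P]
        + cov[fun ω => X c ω j, fun ω => X c ω j; P] := by
    intro c
    have := covariance_add_left (hm c i) (hm c j) ((hm c i).add (hm c j))
    rw [covariance_add_right (hm c i) (hm c i) (hm c j),
      covariance_add_right (hm c j) (hm c i) (hm c j),
      covariance_comm (fun ω => X c ω j) (fun ω => X c ω i)] at this
    refine this.trans ?_
    ring
  have hsum := eq_mul_of_additive_of_nonneg
    (f := fun c => cov[fun ω => X c ω i + X c ω j, fun ω => X c ω i + X c ω j; P])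
    (fun a b ha hb => by
      simp only [hexp, hX.covariance_add _ _ ha hb]
      ring) (fun c _ => by
        exact (variance_nonneg _ _).trans_eq
          (covariance_self ((hm c i).add (hm c j)).aemeasurable).symm) ha
  simp only [hexp] at hsum
  rw [hvar i ha, hvar j ha] at hsum
  simp only [covMat, Matrix.of_apply]
  linarith

theorem covariance_eval (hX : IsOperatorBrownianMotion X P) (s t : ℝ) (i j : Fin n) :
    cov[fun ω => X s ω i, fun ω => X t ω j; P] = bmCov s t * covMat X P i j :=
  covariance_eq_bmCov_mul (U := fun t ω => X t ω i) (V := fun t ω => X t ω j)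
    (fun t => hX.memLp_eval t i) (fun t => hX.memLp_eval t j) (hX.zero_apply i) (hX.zero_apply j)
    (fun _ _ _ => hX.covariance_increments_eq_zero i j)
    (fun _ _ _ => hX.covariance_increments_eq_zero j i)
    (fun s t hst => by
      rw [hX.covariance_increment i j s t, hX.covariance_eval_self i j (sub_nonneg.2 hst)]) s t

theorem covariance_dotProduct (hX : IsOperatorBrownianMotion X P) (u v : Fin n → ℝ) (t : ℝ) :
    cov[fun ω => u ⬝ᵥ X t ω, fun ω => v ⬝ᵥ X t ω; P]
      = ∑ i, ∑ j, u i * v j * cov[fun ω => X t ω i, fun ω => X t ω j; P] := by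
  simp only [dotProduct]
  rw [covariance_fun_sum_fun_sum (fun i => (hX.memLp_eval t i).const_mul _)
    (fun i => (hX.memLp_eval t i).const_mul _)]
  simp_rw [covariance_const_mul_left, covariance_const_mul_right, mul_assoc]

theorem variance_dotProduct (hX : IsOperatorBrownianMotion X P) (u : Fin n → ℝ) :
    cov[fun ω => u ⬝ᵥ X 1 ω, fun ω => u ⬝ᵥ X 1 ω; P] = u ⬝ᵥ (covMat X P).mulVec u := by
  rw [hX.covariance_dotProduct]
  simp only [dotProduct, Matrix.mulVec, covMat, Matrix.of_apply, Finset.mul_sum]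
  exact Finset.sum_congr rfl fun i _ => Finset.sum_congr rfl fun j _ => by ring

/-- If `u ⬝ Γ u = 0`, then `u ⬝ X 1` is almost surely a constant `c`, so `X 1` lies in the affine
subspace `u ⬝ x = c`. Properness makes this the whole space; comparing the points `0` and `u` gives
`u ⬝ u = 0`. -/
theorem covMat_posDef (hX : IsOperatorBrownianMotion X P) : (covMat X P).PosDef := by
  refine Matrix.PosDef.of_dotProduct_mulVec_pos ?_ fun u hu => ?_
  · ext i j
    simp [covMat, covariance_comm (fun ω => X 1 ω i)]
  have hm : MemLp (fun ω => u ⬝ᵥ X 1 ω) 2 P :=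
    memLp_finsetSum _ fun i _ => (hX.memLp_eval 1 i).const_mul _
  have hself := hX.variance_dotProduct u
  rw [covariance_self hm.aemeasurable] at hself
  rw [star_trivial, ← hself]
  refine lt_of_le_of_ne (variance_nonneg _ _) fun h0 => hu ?_
  have hae := ae_eq_integral_of_variance_eq_zero hm h0.symm
  set c := ∫ ω, u ⬝ᵥ X 1 ω ∂P
  let S : AffineSubspace ℝ (Fin n → ℝ) :=
    { carrier := {x | u ⬝ᵥ x = c}
      smul_vsub_vadd_mem' := fun r x y z hx hy hz => by
        simp only [Set.mem_ofPred_eq] at hx hy hz ⊢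
        simp [dotProduct_add, dotProduct_smul, dotProduct_sub, hx, hy, hz] }
  have hS : S = ⊤ := hX.oss.proper 1 one_ne_zero S hae
  have hmem : ∀ x : Fin n → ℝ, u ⬝ᵥ x = c := fun x => by
    have : x ∈ S := hS ▸ AffineSubspace.mem_top ℝ _ x
    exact this
  have h1 := hmem u
  rw [← hmem 0, dotProduct_zero] at h1
  exact dotProduct_self_eq_zero.1 h1

theorem integral_add (hX : IsOperatorBrownianMotion X P) (s t : ℝ) (i : Fin n) :
    ∫ ω, X (s + t) ω i ∂P = ∫ ω, X s ω i ∂P + ∫ ω, X t ω i ∂P := by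
  have h := ((hX.identDistrib_increment s (s + t)).comp (measurable_pi_apply i)).integral_eq
  simp only [Function.comp_apply, add_sub_cancel_left, Pi.sub_apply] at h
  rw [integral_sub ((hX.memLp_eval _ i).integrable (by norm_num))
    ((hX.memLp_eval _ i).integrable (by norm_num))] at h
  linarith

/-- Scaling by `2` is compared with additivity of the mean (`2 t = t + t`): the mean would be an
eigenvector of `A = 2 ^ H` for the eigenvalue `2`, whereas `A Γ Aᵀ = 2 Γ` says that `A / √2`
preserves the form `Γ⁻¹`. -/
theorem integral_eval (hX : IsOperatorBrownianMotion X P) (t : ℝ) (i : Fin n) :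
    ∫ ω, X t ω i ∂P = 0 := by
  obtain ⟨H, hH⟩ := hX.oss.scaling
  set A := matPow 2 H
  set Γ := covMat X P
  have hΓ := hX.covMat_posDef
  set m : Fin n → ℝ := fun i => ∫ ω, X t ω i ∂P with hm
  have hAt : ∀ t, IdentDistrib (X (2 * t)) (fun ω => A.mulVec (X t ω)) P P :=
    fun t => (hH 2 two_pos).identDistrib_eval t
  have hAm : A.mulVec m = (2 : ℝ) • m := by
    ext k
    have h := ((hAt t).comp (measurable_pi_apply k)).integral_eq
    simp only [Function.comp_apply, two_mul, hX.integral_add] at h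
    simp only [Matrix.mulVec, dotProduct] at h
    rw [integral_finsetSum _ fun j _ =>
      ((hX.memLp_eval _ j).integrable (by norm_num)).const_mul _] at h
    simp only [integral_const_mul] at h
    simp only [Matrix.mulVec, dotProduct, Pi.smul_apply, smul_eq_mul, two_mul, hm]
    exact h.symm
  have hAΓ : A * Γ * A.transpose = (2 : ℝ) • Γ := by
    ext k l
    have h := covariance_eval_eq_of_identDistrib (hAt 1) k l
    rw [mul_one, hX.covariance_eval_self k l two_pos.le] at h
    have h2 := hX.covariance_dotProduct (A k) (A l) 1
    simp only [Matrix.mulVec] at h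
    rw [h2] at h
    rw [Matrix.smul_apply, smul_eq_mul, h, Matrix.mul_apply]
    simp only [Matrix.mul_apply, Matrix.transpose_apply, Finset.sum_mul]
    rw [Finset.sum_comm]
    refine Finset.sum_congr rfl fun i _ => Finset.sum_congr rfl fun j _ => ?_
    simp only [Γ, covMat, Matrix.of_apply]
    ring
  have hΓu : IsUnit Γ := hΓ.isUnit
  -- Taking determinants in `A Γ Aᵀ = 2 Γ` gives invertibility.
  have hA : IsUnit A := by
    have hu : IsUnit (A * Γ * A.transpose) := by
      rw [hAΓ]
      exact hΓu.smul (Units.mk0 (2 : ℝ) two_ne_zero)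
    rw [Matrix.isUnit_iff_isUnit_det] at hu ⊢
    rw [Matrix.det_mul, Matrix.det_mul, Matrix.det_transpose] at hu
    exact isUnit_of_mul_isUnit_right hu
  have hinjA := Matrix.mulVec_injective_of_isUnit hA
  have hinjΓ := Matrix.mulVec_injective_of_isUnit hΓu
  obtain ⟨w, hw⟩ : ∃ w, Γ.mulVec w = m := Matrix.mulVec_surjective_iff_isUnit.2 hΓu m
  have hAw : A.transpose.mulVec w = w := by
    refine hinjΓ (hinjA ?_)
    rw [Matrix.mulVec_mulVec, Matrix.mulVec_mulVec, hAΓ, Matrix.smul_mulVec, hw, hAm]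
  -- Here `w = Γ⁻¹ m`, so this says `mᵀ Γ⁻¹ m = 0`.
  have h0 : w ⬝ᵥ m = 0 := by
    have : w ⬝ᵥ A.mulVec m = w ⬝ᵥ m := by
      rw [Matrix.dotProduct_mulVec, ← Matrix.mulVec_transpose, hAw]
    rw [hAm, dotProduct_smul, smul_eq_mul] at this
    linarith
  have hw0 : w = 0 := by
    by_contra hne
    have := hΓ.dotProduct_mulVec_pos hne
    rw [star_trivial, hw, h0] at this
    exact lt_irrefl _ this
  have : m = 0 := by rw [← hw, hw0, Matrix.mulVec_zero]
  exact congrFun this i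

end IsOperatorBrownianMotion

open scoped MatrixOrder in
/-- A positive definite matrix has a positive definite square root. -/
theorem exists_posDef_sqrt {Γ : Matrix (Fin n) (Fin n) ℝ} (hΓ : Γ.PosDef) :
    ∃ W : Matrix (Fin n) (Fin n) ℝ, W.PosDef ∧ W * W.transpose = Γ := by
  have hs : (CFC.sqrt Γ).PosSemidef := Matrix.nonneg_iff_posSemidef.1 (CFC.sqrt_nonneg Γ)
  have hmul : CFC.sqrt Γ * CFC.sqrt Γ = Γ := CFC.sqrt_mul_sqrt_self Γ hΓ.posSemidef.nonneg
  have ht : (CFC.sqrt Γ).transpose = CFC.sqrt Γ := by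
    simpa [Matrix.conjTranspose_eq_transpose_of_trivial] using hs.isHermitian.eq
  refine ⟨CFC.sqrt Γ, ?_, by rw [ht, hmul]⟩
  rw [hs.posDef_iff_isUnit]
  exact isUnit_of_mul_isUnit_left (hmul.symm ▸ hΓ.isUnit)

end OBM

/-! ### Two-sided Brownian motion: Gaussianity and covariance. -/

namespace OBM

variable {Ω : Type*} [MeasurableSpace Ω] {Q : Measure Ω} {n : ℕ}

namespace IsStandardBM

variable {b : ℝ → Ω → ℝ}

theorem hasLaw_eval (hb : IsStandardBM b Q) (t : ℝ) :
    HasLaw (b t) (gaussianReal 0 (Real.nnabs t)) Q := by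
  have h := hb.law_increment 0 t
  rw [sub_zero] at h
  refine h.congr ?_
  filter_upwards [hb.zero] with ω hω
  simp [hω]

theorem isGaussianProcess_Ici (hb : IsStandardBM b Q) (a : ℝ) :
    IsGaussianProcess (fun (t : Set.Ici a) ω => b t ω - b a ω) Q := by
  refine HasIndepIncrements.isGaussianProcess (fun t => (hb.law_increment a t).hasGaussianLaw)
    (ae_of_all _ fun ω => sub_self _) fun m t ht => ?_
  have := hb.indep_increments m (fun k => (t k : ℝ)) fun i j hij => ht hij
  simpa using this

/-- Independent increments give Gaussianity on a half-line `[a, ∞)`, relative to the value at `a`.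
With `a` below `0` and all the times in `I`, the identity `b t - b 0 = (b t - b a) - (b 0 - b a)`
restores the normalization at `0`. -/
theorem isGaussianProcess (hb : IsStandardBM b Q) : IsGaussianProcess b Q where
  hasGaussianLaw I := by
    obtain ⟨a, ha⟩ := (insert 0 I).finite_toSet.bddBelow
    have ha0 : a ≤ 0 := ha (by simp)
    have haI : ∀ t ∈ I, a ≤ t := fun t ht => ha (by simp [ht])
    have hG : IsGaussianProcess (fun (t : Set.Ici a) => b t) Q := by
      have : IsGaussianProcess (fun (t : Set.Ici a) ω => b t ω - b 0 ω) Q :=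
        IsGaussianProcess.of_isGaussianProcess (hb.isGaussianProcess_Ici a) fun t =>
          ⟨{t, ⟨0, ha0⟩},
            ContinuousLinearMap.proj (R := ℝ)
              (φ := fun _ : ({t, ⟨0, ha0⟩} : Finset (Set.Ici a)) => ℝ) ⟨t, by simp⟩ -
            ContinuousLinearMap.proj (R := ℝ)
              (φ := fun _ : ({t, ⟨0, ha0⟩} : Finset (Set.Ici a)) => ℝ) ⟨⟨0, ha0⟩, by simp⟩,
            fun ω => by simp⟩
      refine this.congr fun t => ?_
      filter_upwards [hb.zero] with ω hω
      simp [hω]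
    have h := (hG.comp_right fun t : I => (⟨t, haI t t.2⟩ : Set.Ici a)).hasGaussianLaw Finset.univ
    exact h.map_fun (ContinuousLinearMap.pi fun i => ContinuousLinearMap.proj (R := ℝ)
      (φ := fun _ : (Finset.univ : Finset I) => ℝ) ⟨i, by simp⟩)

theorem memLp_eval (hb : IsStandardBM b Q) (t : ℝ) : MemLp (b t) 2 Q :=
  (hb.hasLaw_eval t).hasGaussianLaw.memLp_two

theorem integral_eval (hb : IsStandardBM b Q) (t : ℝ) : ∫ ω, b t ω ∂Q = 0 := by
  rw [(hb.hasLaw_eval t).integral_eq, integral_id_gaussianReal]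

theorem covariance_eval [IsProbabilityMeasure Q] (hb : IsStandardBM b Q) (s t : ℝ) :
    cov[b s, b t; Q] = bmCov s t := by
  have hincr : ∀ r s t, r ≤ s → s ≤ t →
      cov[fun ω => b s ω - b r ω, fun ω => b t ω - b s ω; Q] = 0 := fun r s t hrs hst =>
    (hb.indep_increments.indepFun_sub_sub hrs hst).covariance_eq_zero
      ((hb.memLp_eval s).sub (hb.memLp_eval r)) ((hb.memLp_eval t).sub (hb.memLp_eval s))
  rw [covariance_eq_bmCov_mul hb.memLp_eval hb.memLp_eval hb.zero hb.zero hincr hincr (γ := 1)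
    (fun s t hst => ?_), mul_one]
  refine (covariance_self ((hb.memLp_eval t).sub (hb.memLp_eval s)).aemeasurable).trans ?_
  refine Eq.trans (b := Var[fun ω => b t ω - b s ω; Q]) rfl ?_
  rw [(hb.law_increment s t).variance_eq, variance_id_gaussianReal]
  simp [abs_of_nonneg (sub_nonneg.2 hst)]

end IsStandardBM

namespace IsStandardBMVector

variable {B : ℝ → Ω → Fin n → ℝ}

theorem isGaussianProcess (hB : IsStandardBMVector B Q) :
    IsGaussianProcess (fun (p : ℝ × Fin n) ω => B p.1 ω p.2) Q where
  hasGaussianLaw I := by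
    classical
    set J := I.image Prod.fst
    have hind : iIndepFun (fun (i : Fin n) ω => J.restrict (fun t => B t ω i)) Q :=
      hB.indep.comp (fun _ x => J.restrict x) fun _ => Finset.measurable_restrict J
    have hG := iIndepFun.hasGaussianLaw
      (fun i => (IsStandardBM.isGaussianProcess (hB.component i)).hasGaussianLaw J) hind
    exact hG.map_fun (ContinuousLinearMap.pi fun p : I =>
      (ContinuousLinearMap.proj (R := ℝ) (φ := fun _ : J => ℝ)
        ⟨p.1.1, Finset.mem_image_of_mem _ p.2⟩).comp
      (ContinuousLinearMap.proj (R := ℝ) (φ := fun _ : Fin n => J → ℝ) p.1.2))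

theorem covariance_eval [IsProbabilityMeasure Q] (hB : IsStandardBMVector B Q) (s t : ℝ)
    (i j : Fin n) :
    cov[fun ω => B s ω i, fun ω => B t ω j; Q] = if i = j then bmCov s t else 0 := by
  split_ifs with hij
  · subst hij
    exact (hB.component i).covariance_eval s t
  · exact ((hB.indep.indepFun hij).comp (measurable_pi_apply s)
      (measurable_pi_apply t)).covariance_eq_zero ((hB.component i).memLp_eval s)
      ((hB.component j).memLp_eval t)

variable (W : Matrix (Fin n) (Fin n) ℝ)

theorem isGaussianProcess_mulVec (hB : IsStandardBMVector B Q) :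
    IsGaussianProcess (fun (p : ℝ × Fin n) ω => W.mulVec (B p.1 ω) p.2) Q := by
  have := (isGaussianProcess_of_coord hB.isGaussianProcess).comp_left
    (fun _ => (Matrix.mulVecLin W).toContinuousLinearMap)
  exact isGaussianProcess_coord this

theorem integral_mulVec (hB : IsStandardBMVector B Q) (t : ℝ) (i : Fin n) :
    ∫ ω, W.mulVec (B t ω) i ∂Q = 0 := by
  simp only [Matrix.mulVec, dotProduct]
  rw [integral_finsetSum _ fun j _ =>
    ((hB.component j).hasLaw_eval t).hasGaussianLaw.integrable.const_mul _]
  simp [integral_const_mul, (hB.component _).integral_eval]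

theorem covariance_mulVec [IsProbabilityMeasure Q] (hB : IsStandardBMVector B Q) (s t : ℝ)
    (i j : Fin n) :
    cov[fun ω => W.mulVec (B s ω) i, fun ω => W.mulVec (B t ω) j; Q]
      = bmCov s t * (W * W.transpose) i j := by
  simp only [Matrix.mulVec, dotProduct]
  rw [covariance_fun_sum_fun_sum (fun k => ((hB.component k).memLp_eval s).const_mul _)
    (fun k => ((hB.component k).memLp_eval t).const_mul _)]
  simp_rw [covariance_const_mul_left, covariance_const_mul_right, hB.covariance_eval,
    Matrix.mul_apply, Matrix.transpose_apply, Finset.mul_sum]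
  refine Finset.sum_congr rfl fun k _ => ?_
  simp only [mul_ite, mul_zero, Finset.sum_ite_eq, Finset.mem_univ, if_true]
  ring

end IsStandardBMVector

end OBM

/-! ### The integral of `(1 - cos (t x)) / x²`. -/

section Integrals

theorem integrable_one_sub_cos_div_sq : Integrable (fun x : ℝ => (1 - Real.cos x) / x ^ 2) := by
  -- The constant `4` covers both ranges: `1 - cos x ≤ x² / 2` when `x² ≤ 1`, and `1 - cos x ≤ 2`
  -- when `x² ≥ 1`.
  refine Integrable.mono' (integrable_inv_one_add_sq.const_mul 4)
    (by fun_prop : Measurable _).aestronglyMeasurable (ae_of_all _ fun x => ?_)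
  have h0 : 0 ≤ 1 - Real.cos x := sub_nonneg.2 (Real.cos_le_one x)
  rw [Real.norm_of_nonneg (by positivity)]
  rcases eq_or_ne x 0 with rfl | hx
  · simp
  have hx2 : 0 < x ^ 2 := by positivity
  rw [← div_eq_mul_inv, div_le_div_iff₀ hx2 (by positivity)]
  have h1 := Real.one_sub_sq_div_two_le_cos (x := x)
  have h2 := Real.neg_one_le_cos x
  rcases le_total (x ^ 2) 1 with h | h
  · nlinarith
  · nlinarith

theorem integral_mul_exp_neg_mul_Ioi {x : ℝ} (hx : 0 < x) :
    ∫ y in Set.Ioi (0 : ℝ), y * Real.exp (-(x * y)) = (x ^ 2)⁻¹ := by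
  have h := Real.integral_rpow_mul_exp_neg_mul_Ioi (a := 2) (r := x) two_pos hx
  rw [Real.Gamma_two, mul_one, Real.rpow_two, one_div, inv_pow] at h
  rw [← h]
  refine setIntegral_congr_fun measurableSet_Ioi fun y _ => ?_
  norm_num

theorem integrableOn_exp_neg_mul_mul_cos_Ioi {y : ℝ} (hy : 0 < y) :
    IntegrableOn (fun x : ℝ => Real.exp (-(x * y)) * Real.cos x) (Set.Ioi 0) := by
  have h := integrableOn_exp_mul_complex_Ioi (a := -y + Complex.I) (by simpa) 0
  refine IntegrableOn.congr_fun (f := fun x : ℝ =>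
    RCLike.re (Complex.exp ((-y + Complex.I) * x))) h.re (fun x _ => ?_) measurableSet_Ioi
  simp [Complex.exp_re, mul_comm]

theorem integral_exp_neg_mul_mul_cos_Ioi {y : ℝ} (hy : 0 < y) :
    ∫ x in Set.Ioi (0 : ℝ), Real.exp (-(x * y)) * Real.cos x = y / (1 + y ^ 2) := by
  have hre : ((-y : ℂ) + Complex.I).re < 0 := by simpa
  have hi := integrableOn_exp_mul_complex_Ioi hre 0
  have h := integral_exp_mul_complex_Ioi hre 0
  have h2 := congrArg Complex.re h
  rw [← RCLike.re_eq_complex_re, ← integral_re hi] at h2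
  have e : ∀ x : ℝ, RCLike.re (Complex.exp ((-y + Complex.I) * x))
      = Real.exp (-(x * y)) * Real.cos x := fun x => by
    simp [Complex.exp_re, mul_comm]
  simp_rw [e] at h2
  rw [h2]
  simp [Complex.div_re, Complex.normSq_apply]
  ring

/-- Write `1 / x²` as `∫ y exp (-x y) dy` over `y > 0` and exchange the integrals. The inner
integral becomes `y (1 / y - y / (1 + y²)) = 1 / (1 + y²)`, whose integral over the half-line is `π
/ 2`. -/
theorem integral_one_sub_cos_div_sq_Ioi :
    ∫ x in Set.Ioi (0 : ℝ), (1 - Real.cos x) / x ^ 2 = Real.pi / 2 := by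
  set μ : Measure ℝ := volume.restrict (Set.Ioi 0)
  set F : ℝ → ℝ → ℝ := fun x y => (1 - Real.cos x) * (y * Real.exp (-(x * y))) with hF
  have hpos : ∀ᵐ x ∂μ, 0 < x := ae_restrict_mem measurableSet_Ioi
  have hxint : ∀ x, 0 < x → ∫ y, F x y ∂μ = (1 - Real.cos x) / x ^ 2 := fun x hx => by
    simp only [hF]
    rw [integral_const_mul, integral_mul_exp_neg_mul_Ioi hx, div_eq_mul_inv]
  have hint : Integrable (Function.uncurry F) (μ.prod μ) := by
    have hm : Measurable (Function.uncurry F) := by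
      simp only [hF, Function.uncurry_def]
      fun_prop
    rw [integrable_prod_iff hm.aestronglyMeasurable]
    constructor
    · filter_upwards [hpos] with x hx
      have hne : Integrable (fun y : ℝ => y * Real.exp (-(x * y))) μ := by
        -- A Bochner integral that is not `0` is the integral of an integrable function.
        refine Integrable.of_integral_ne_zero ?_
        rw [integral_mul_exp_neg_mul_Ioi hx]
        positivity
      have hmul := hne.const_mul (1 - Real.cos x)
      exact hmul
    · refine (integrable_one_sub_cos_div_sq.integrableOn (s := Set.Ioi 0)).congr ?_
      filter_upwards [hpos] with x hx
      rw [← hxint x hx]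
      refine integral_congr_ae ?_
      filter_upwards [hpos] with y hy
      have := Real.cos_le_one x
      rw [Real.norm_of_nonneg]
      · rfl
      · exact mul_nonneg (by linarith) (by positivity)
  have hswap := integral_integral_swap hint
  have hl : ∫ x, ∫ y, F x y ∂μ ∂μ = ∫ x in Set.Ioi (0 : ℝ), (1 - Real.cos x) / x ^ 2 :=
    integral_congr_ae (hpos.mono fun x hx => hxint x hx)
  have hr : ∫ y, ∫ x, F x y ∂μ ∂μ = ∫ y in Set.Ioi (0 : ℝ), (1 + y ^ 2)⁻¹ := by
    refine integral_congr_ae (hpos.mono fun y hy => ?_)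
    have e : ∀ x, F x y = y * (Real.exp (-y * x) - Real.exp (-(x * y)) * Real.cos x) := fun x => by
      simp only [hF, neg_mul, mul_comm x y]
      ring
    simp_rw [e]
    have h1 : IntegrableOn (fun x => Real.exp (-y * x)) (Set.Ioi 0) :=
      integrableOn_exp_mul_Ioi (neg_lt_zero.2 hy) 0
    rw [integral_const_mul, integral_sub h1 (integrableOn_exp_neg_mul_mul_cos_Ioi hy),
      integral_exp_neg_mul_mul_cos_Ioi hy, integral_exp_mul_Ioi (neg_lt_zero.2 hy)]
    simp
    field_simp
    ring
  rw [← hl, hswap, hr, integral_Ioi_inv_one_add_sq, Real.arctan_zero, sub_zero]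

theorem integrable_one_sub_cos_mul_div_sq (t : ℝ) :
    Integrable (fun x : ℝ => (1 - Real.cos (t * x)) / x ^ 2) := by
  rcases eq_or_ne t 0 with rfl | ht
  · simp
  refine ((integrable_one_sub_cos_div_sq.comp_mul_left' ht).const_mul (t ^ 2)).congr
    (ae_of_all _ fun x => ?_)
  simp only
  rcases eq_or_ne x 0 with rfl | hx
  · simp
  · field_simp

theorem integral_one_sub_cos_mul_div_sq (t : ℝ) :
    ∫ x : ℝ, (1 - Real.cos (t * x)) / x ^ 2 = Real.pi * |t| := by
  rcases eq_or_ne t 0 with rfl | ht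
  · simp
  have h1 : ∫ x : ℝ, (1 - Real.cos x) / x ^ 2 = Real.pi := by
    have h := integral_comp_abs (f := fun x : ℝ => (1 - Real.cos x) / x ^ 2)
    simp only [Real.cos_abs, sq_abs] at h
    rw [h, integral_one_sub_cos_div_sq_Ioi]
    ring
  have e : ∀ x : ℝ, (1 - Real.cos (t * x)) / x ^ 2
      = t ^ 2 * ((1 - Real.cos (t * x)) / (t * x) ^ 2) := fun x => by
    rcases eq_or_ne x 0 with rfl | hx
    · simp
    · field_simp
  simp_rw [e]
  rw [integral_const_mul,
    Measure.integral_comp_mul_left (fun x : ℝ => (1 - Real.cos x) / x ^ 2) t, h1, smul_eq_mul,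
    abs_inv, ← sq_abs]
  have := abs_pos.2 ht
  field_simp

end Integrals

/-! ### The spectral kernel in `L²`. -/

namespace OBM

/-- This Hermitian symmetry is what makes the spectral integral real. -/
theorem kernel_neg (t x : ℝ) : kernel t (-x) = (starRingEnd ℂ) (kernel t x) := by
  simp [kernel, ← Complex.exp_conj]

theorem measurable_kernel (t : ℝ) : Measurable (kernel t) := by
  unfold kernel
  fun_prop

/-- The real part of `(exp (i s x) - 1) (exp (-i t x) - 1)` is a combination of cosines, arranged
here into terms that are separately integrable. At `x = 0` both sides vanish by the convention for
division by zero. -/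
theorem re_kernel_mul_conj_kernel (s t x : ℝ) :
    (kernel s x * (starRingEnd ℂ) (kernel t x)).re = (1 - Real.cos (s * x)) / x ^ 2
      + (1 - Real.cos (t * x)) / x ^ 2 - (1 - Real.cos ((t - s) * x)) / x ^ 2 := by
  rcases eq_or_ne x 0 with rfl | hx
  · simp [kernel]
  have hxc : (x : ℂ) ≠ 0 := by exact_mod_cast hx
  have hk : kernel s x * (starRingEnd ℂ) (kernel t x) =
      (Complex.exp ((s * x : ℝ) * Complex.I) - 1) *
        (Complex.exp ((-(t * x) : ℝ) * Complex.I) - 1) / ((x ^ 2 : ℝ) : ℂ) := by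
    simp only [kernel, map_div₀, map_sub, map_mul, map_one, ← Complex.exp_conj, Complex.conj_I,
      Complex.conj_ofReal]
    push_cast
    rw [div_mul_div_comm]
    congr 1
    · congr 3 <;> ring_nf
    · ring_nf
      simp
  rw [hk, Complex.div_ofReal_re]
  simp only [Complex.mul_re, Complex.sub_re, Complex.sub_im, Complex.one_re, Complex.one_im,
    Complex.exp_ofReal_mul_I_re, Complex.exp_ofReal_mul_I_im, Real.cos_neg, Real.sin_neg]
  rw [sub_mul t s x, Real.cos_sub]
  ring

theorem memLp_kernel (t : ℝ) : MemLp (kernel t) 2 volume := by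
  rw [memLp_two_iff_integrable_sq_norm (measurable_kernel t).aestronglyMeasurable]
  have h := integrable_one_sub_cos_mul_div_sq t
  refine (h.add h).congr (ae_of_all _ fun x => ?_)
  have := re_kernel_mul_conj_kernel t t x
  rw [Complex.mul_conj, Complex.ofReal_re, Complex.normSq_eq_norm_sq] at this
  simp [this]

theorem re_integral_kernel_mul_conj_kernel (s t : ℝ) :
    (∫ x, kernel s x * (starRingEnd ℂ) (kernel t x)).re = 2 * Real.pi * bmCov s t := by
  have hi : Integrable (fun x => kernel s x * (starRingEnd ℂ) (kernel t x)) :=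
    (memLp_kernel s).integrable_mul (memLp_kernel t).star
  rw [← RCLike.re_eq_complex_re, ← integral_re hi]
  simp_rw [RCLike.re_eq_complex_re, re_kernel_mul_conj_kernel]
  have h := integrable_one_sub_cos_mul_div_sq
  have ha : Integrable (fun x : ℝ => (1 - Real.cos (s * x)) / x ^ 2
      + (1 - Real.cos (t * x)) / x ^ 2) := (h s).add (h t)
  rw [integral_sub ha (h _), integral_add (h s) (h t)]
  simp_rw [integral_one_sub_cos_mul_div_sq]
  rw [bmCov]
  ring

end OBM

/-! ### Gaussian random measures and integrals of simple functions. -/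

theorem integral_sum_mul_sum {α ι κ 𝕜 : Type*} [MeasurableSpace α] {μ : Measure α} [RCLike 𝕜]
    (I : Finset ι) (J : Finset κ) {u : ι → α → 𝕜} {v : κ → α → 𝕜} (hu : ∀ a, MemLp (u a) 2 μ)
    (hv : ∀ b, MemLp (v b) 2 μ) (c : ι → 𝕜) (d : κ → 𝕜) :
    ∫ x, (∑ a ∈ I, c a * u a x) * (∑ b ∈ J, d b * v b x) ∂μ
      = ∑ a ∈ I, ∑ b ∈ J, c a * d b * ∫ x, u a x * v b x ∂μ := by
  have hi : ∀ a b, Integrable (fun x => c a * d b * (u a x * v b x)) μ := fun a b =>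
    ((hu a).integrable_mul (hv b)).const_mul _
  have e : ∀ x, (∑ a ∈ I, c a * u a x) * (∑ b ∈ J, d b * v b x)
      = ∑ a ∈ I, ∑ b ∈ J, c a * d b * (u a x * v b x) := fun x => by
    rw [Finset.sum_mul_sum]
    exact Finset.sum_congr rfl fun a _ => Finset.sum_congr rfl fun b _ => by ring
  simp_rw [e]
  rw [integral_finsetSum _ fun a _ => integrable_finsetSum _ fun b _ => hi a b]
  refine Finset.sum_congr rfl fun a _ => ?_
  rw [integral_finsetSum _ fun b _ => hi a b]
  exact Finset.sum_congr rfl fun b _ => integral_const_mul _ _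

theorem ProbabilityTheory.IsGaussianProcess.of_finset_sum {Ω S T κ : Type*} [MeasurableSpace Ω]
    {P : Measure Ω} {G : T → Ω → ℝ} {Y : S → Ω → ℝ} (hG : IsGaussianProcess G P)
    (K : S → Finset κ) (c : S → κ → ℝ) (φ : S → κ → T)
    (h : ∀ s ω, Y s ω = ∑ k ∈ K s, c s k * G (φ s k) ω) : IsGaussianProcess Y P := by
  classical
  refine hG.of_isGaussianProcess fun s => ⟨(K s).image (φ s),
    ∑ k ∈ (K s).attach, c s k • ContinuousLinearMap.proj (R := ℝ)
      (φ := fun _ : ((K s).image (φ s) : Finset T) => ℝ)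
      ⟨φ s k, Finset.mem_image_of_mem _ k.2⟩, fun ω => ?_⟩
  rw [h, ← Finset.sum_attach]
  simp

theorem ProbabilityTheory.IsGaussianProcess.sumElim_of_indepFun {Ω S T : Type*} [MeasurableSpace Ω]
    {P : Measure Ω} {X : S → Ω → ℝ} {Y : T → Ω → ℝ} (hX : IsGaussianProcess X P)
    (hY : IsGaussianProcess Y P) (h : IndepFun (fun ω s => X s ω) (fun ω t => Y t ω) P) :
    IsGaussianProcess (Sum.elim X Y) P where
  hasGaussianLaw I := by
    have hind := h.comp (Finset.measurable_restrict I.toLeft) (Finset.measurable_restrict I.toRight)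
    have hG := IndepFun.hasGaussianLaw (hX.hasGaussianLaw I.toLeft) (hY.hasGaussianLaw I.toRight)
      hind
    let L : (I.toLeft → ℝ) × (I.toRight → ℝ) →L[ℝ] (I → ℝ) :=
      ContinuousLinearMap.pi fun p => match p with
        | ⟨Sum.inl s, hs⟩ => (ContinuousLinearMap.proj (R := ℝ)
            (φ := fun _ : I.toLeft => ℝ) ⟨s, Finset.mem_toLeft.2 hs⟩).comp
            (ContinuousLinearMap.fst ℝ _ _)
        | ⟨Sum.inr t, ht⟩ => (ContinuousLinearMap.proj (R := ℝ)
            (φ := fun _ : I.toRight => ℝ) ⟨t, Finset.mem_toRight.2 ht⟩).comp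
            (ContinuousLinearMap.snd ℝ _ _)
    refine (hG.map_fun L).congr (ae_of_all _ fun ω => ?_)
    ext ⟨p, hp⟩
    cases p <;> rfl

theorem eLpNorm_pi_le_sum {α ι : Type*} [Fintype ι] [MeasurableSpace α] {μ : Measure α}
    {f : α → ι → ℂ} (hf : ∀ i, AEStronglyMeasurable (fun x => f x i) μ) :
    eLpNorm f 2 μ ≤ ∑ i, eLpNorm (fun x => f x i) 2 μ := by
  calc eLpNorm f 2 μ ≤ eLpNorm (∑ i, fun x => ‖f x i‖) 2 μ := by
        refine eLpNorm_mono fun x => ?_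
        rw [Finset.sum_apply, Real.norm_of_nonneg (Finset.sum_nonneg fun i _ => norm_nonneg _)]
        exact (pi_norm_le_iff_of_nonneg (Finset.sum_nonneg fun i _ => norm_nonneg _)).2 fun i =>
          Finset.single_le_sum (f := fun i => ‖f x i‖) (fun i _ => norm_nonneg _)
            (Finset.mem_univ i)
    _ ≤ ∑ i, eLpNorm (fun x => ‖f x i‖) 2 μ :=
        eLpNorm_sum_le (fun i _ => (hf i).norm) (by norm_num)
    _ = _ := by simp_rw [eLpNorm_norm]

theorem eLpNorm_eval_le {α ι : Type*} [Fintype ι] [MeasurableSpace α] {μ : Measure α}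
    (f : α → ι → ℂ) (i : ι) : eLpNorm (fun x => f x i) 2 μ ≤ eLpNorm f 2 μ :=
  eLpNorm_mono fun x => norm_le_pi_norm (f x) i

namespace OBM

variable {Ω : Type*} [MeasurableSpace Ω] {Q : Measure Ω} {n : ℕ}

/-- The reflection `-A` of a Borel set of finite measure. -/
def FinBorel.neg (A : FinBorel) : FinBorel :=
  ⟨(fun x : ℝ => -x) ⁻¹' A, measurable_neg A.2.1, by
    rw [(Measure.measurePreserving_neg volume).measure_preimage A.2.1.nullMeasurableSet]
    exact A.2.2⟩

/-- The indicator function of a Borel set of finite measure. -/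
noncomputable def FinBorel.ind (A : FinBorel) : ℝ → ℂ := (A : Set ℝ).indicator 1

theorem FinBorel.memLp_ind (A : FinBorel) : MemLp A.ind 2 volume :=
  memLp_indicator_const 2 A.2.1 (1 : ℂ) (Or.inr A.2.2.ne)

theorem FinBorel.integral_ind_mul_ind (A B : FinBorel) :
    ∫ x, A.ind x * B.ind x = ((volume.real ((A : Set ℝ) ∩ B) : ℝ) : ℂ) := by
  have e : ∀ x, A.ind x * B.ind x = ((A : Set ℝ) ∩ B).indicator (fun _ => (1 : ℂ)) x := fun x => by
    classical
    simp only [FinBorel.ind, Set.indicator_apply, Set.mem_inter_iff]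
    split_ifs <;> simp_all
  simp_rw [e]
  rw [integral_indicator_const _ (A.2.1.inter B.2.1)]
  simp

theorem FinBorel.ind_neg (A : FinBorel) (x : ℝ) : A.ind (-x) = A.neg.ind x := rfl

theorem FinBorel.conj_ind (A : FinBorel) (x : ℝ) : (starRingEnd ℂ) (A.ind x) = A.ind x := by
  classical
  simp only [FinBorel.ind, Set.indicator_apply]
  split_ifs <;> simp

/-- A Gaussian random measure with values in `ℂⁿ`, whose real and imaginary parts are jointly
Gaussian, with `E Z(dx) Z(dx)* = Γ dx` and `E Z(dx) Z(-dx)ᵀ = Γ dx`. -/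
structure IsGaussianRandomMeasure (Z : Set ℝ → Ω → Fin n → ℂ) (Q : Measure Ω)
    (Γ : Matrix (Fin n) (Fin n) ℝ) : Prop where
  gaussian : IsGaussianProcess (Sum.elim (fun (p : FinBorel × Fin n) ω => (Z p.1 ω p.2).re)
    (fun (p : FinBorel × Fin n) ω => (Z p.1 ω p.2).im)) Q
  memLp : ∀ (A : FinBorel) (i : Fin n), MemLp (fun ω => Z A ω i) 2 Q
  centered : ∀ (A : FinBorel) (i : Fin n), ∫ ω, Z A ω i ∂Q = 0
  cov : ∀ (A A' : FinBorel) (i j : Fin n), ∫ ω, Z A ω i * (starRingEnd ℂ) (Z A' ω j) ∂Q =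
    Γ i j * ∫ x, A.ind x * A'.ind x
  pseudoCov : ∀ (A A' : FinBorel) (i j : Fin n), ∫ ω, Z A ω i * Z A' ω j ∂Q =
    Γ i j * ∫ x, A.ind x * A'.ind (-x)

/-- The symmetries say `Z (-A) = conj (Z A)` almost surely, so the pseudo-covariance of `A` and `A'`
is the covariance of `A` and `-A'`. -/
theorem IsHermitianGaussianMeasure.isGaussianRandomMeasure {Z : Set ℝ → Ω → Fin n → ℂ}
    (hZ : IsHermitianGaussianMeasure Z Q) : IsGaussianRandomMeasure Z Q 1 where
  gaussian := by
    refine IsGaussianProcess.sumElim_of_indepFun (isGaussianProcess_coord hZ.gaussian_re)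
      (isGaussianProcess_coord hZ.gaussian_im) ?_
    have hm : Measurable fun (x : FinBorel → Fin n → ℝ) (p : FinBorel × Fin n) => x p.1 p.2 := by
      fun_prop
    exact hZ.indep.comp hm hm
  memLp A i := by
    have hre := ((isGaussianProcess_coord hZ.gaussian_re).hasGaussianLaw_eval (A, i)).memLp_two
    have him := ((isGaussianProcess_coord hZ.gaussian_im).hasGaussianLaw_eval (A, i)).memLp_two
    exact memLp_re_im_iff.1 ⟨hre, him⟩
  centered := hZ.centered
  cov A A' i j := by
    rw [hZ.cov, A.integral_ind_mul_ind, Matrix.one_apply]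
    split_ifs <;> simp
  pseudoCov A A' i j := by
    have h := hZ.cov A A'.neg i j
    simp_rw [FinBorel.ind_neg]
    rw [A.integral_ind_mul_ind, Matrix.one_apply]
    refine Eq.trans ?_ (h.trans (by split_ifs <;> simp))
    refine integral_congr_ae ?_
    filter_upwards [hZ.symm_re A', hZ.symm_im A'] with ω hr hi
    congr 1
    refine Complex.ext ?_ ?_
    · exact (hr j).symm
    · have := hi j
      simp only [Complex.conj_im]
      exact (neg_eq_iff_eq_neg.2 this).symm

omit [MeasurableSpace Ω] in
theorem matMeasure_apply (W : Matrix (Fin n) (Fin n) ℝ) (Z : Set ℝ → Ω → Fin n → ℂ) (A : Set ℝ)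
    (ω : Ω) (i : Fin n) : matMeasure W Z A ω i = ∑ k, (W i k : ℂ) * Z A ω k := rfl

/-- Since `W` is real, it commutes with conjugation, and the covariance and pseudo-covariance both
change from `1` to `W * Wᵀ`. -/
theorem IsGaussianRandomMeasure.matMeasure {Z : Set ℝ → Ω → Fin n → ℂ}
    (hZ : IsGaussianRandomMeasure Z Q 1) (W : Matrix (Fin n) (Fin n) ℝ) :
    IsGaussianRandomMeasure (matMeasure W Z) Q (W * W.transpose) where
  gaussian := by
    refine hZ.gaussian.of_finset_sum (κ := Fin n) (fun _ => Finset.univ)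
      (fun s k => W (s.elim Prod.snd Prod.snd) k)
      (fun s k => s.map (fun p => (p.1, k)) (fun p => (p.1, k))) fun s ω => ?_
    rcases s with ⟨A, i⟩ | ⟨A, i⟩ <;> simp [matMeasure_apply]
  memLp A i := by
    simp_rw [matMeasure_apply]
    exact memLp_finsetSum _ fun k _ => (hZ.memLp A k).const_mul _
  centered A i := by
    simp_rw [matMeasure_apply]
    have : IsProbabilityMeasure Q := hZ.gaussian.isProbabilityMeasure
    rw [integral_finsetSum _ fun k _ => ((hZ.memLp A k).integrable (by norm_num)).const_mul _]
    simp [integral_const_mul, hZ.centered]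
  cov A A' i j := by
    simp_rw [matMeasure_apply, map_sum, map_mul, Complex.conj_ofReal]
    rw [integral_sum_mul_sum Finset.univ Finset.univ (fun k => hZ.memLp A k)
      (v := fun k ω => (starRingEnd ℂ) (Z A' ω k)) (fun k => (hZ.memLp A' k).star)]
    simp_rw [hZ.cov, Matrix.mul_apply, Matrix.one_apply, Matrix.transpose_apply,
      apply_ite Complex.ofReal]
    push_cast
    simp [Finset.sum_mul, mul_assoc]
  pseudoCov A A' i j := by
    simp_rw [matMeasure_apply]
    rw [integral_sum_mul_sum Finset.univ Finset.univ (fun k => hZ.memLp A k)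
      (fun k => hZ.memLp A' k)]
    simp_rw [hZ.pseudoCov, Matrix.mul_apply, Matrix.one_apply, Matrix.transpose_apply,
      apply_ite Complex.ofReal]
    push_cast
    simp [Finset.sum_mul, mul_assoc]

omit [MeasurableSpace Ω] in
-- The fibre over `0` has infinite measure and is not a `FinBorel`. It is replaced by `∅`, which is
-- harmless because its coefficient is `0`.
theorem exists_simple_representation {s : SimpleFunc ℝ ℂ} (hs : s.FinMeasSupp volume) :
    ∃ A : ℂ → FinBorel, (∀ x, s x = ∑ a ∈ s.range, a * (A a).ind x) ∧
      ∀ (Z : Set ℝ → Ω → Fin n → ℂ) ω i,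
        simpleIntegral Z s ω i = ∑ a ∈ s.range, a * Z (A a) ω i := by
  classical
  refine ⟨fun a => if h : a = 0 then ⟨∅, MeasurableSet.empty, by simp⟩ else
    ⟨s ⁻¹' {a}, s.measurableSet_fiber a, hs.meas_preimage_singleton_ne_zero h⟩, fun x => ?_,
    fun Z ω i => ?_⟩
  · rw [Finset.sum_eq_single (s x)]
    · dsimp only
      split_ifs with h
      · simp [h]
      · simp [FinBorel.ind]
    · intro b _ hb
      dsimp only
      split_ifs with h
      · simp [h]
      · simp [FinBorel.ind, hb.symm]
    · intro h
      exact absurd (s.mem_range_self x) h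
  · simp only [simpleIntegral, Finset.sum_apply, Pi.smul_apply, smul_eq_mul]
    refine Finset.sum_congr rfl fun a _ => ?_
    split_ifs with h
    · simp [h]
    · rfl

namespace IsGaussianRandomMeasure

variable {Z : Set ℝ → Ω → Fin n → ℂ} {Γ : Matrix (Fin n) (Fin n) ℝ}

theorem memLp_simpleIntegral (hZ : IsGaussianRandomMeasure Z Q Γ) {s : SimpleFunc ℝ ℂ}
    (hs : s.FinMeasSupp volume) (i : Fin n) : MemLp (fun ω => simpleIntegral Z s ω i) 2 Q := by
  obtain ⟨A, -, hA⟩ := exists_simple_representation (Ω := Ω) (n := n) hs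
  simp_rw [hA]
  exact memLp_finsetSum _ fun a _ => (hZ.memLp _ _).const_mul _

theorem integral_simpleIntegral (hZ : IsGaussianRandomMeasure Z Q Γ) {s : SimpleFunc ℝ ℂ}
    (hs : s.FinMeasSupp volume) (i : Fin n) : ∫ ω, simpleIntegral Z s ω i ∂Q = 0 := by
  have : IsProbabilityMeasure Q := hZ.gaussian.isProbabilityMeasure
  obtain ⟨A, -, hA⟩ := exists_simple_representation (Ω := Ω) (n := n) hs
  simp_rw [hA]
  rw [integral_finsetSum _ fun a _ => ((hZ.memLp _ _).integrable (by norm_num)).const_mul _]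
  simp [integral_const_mul, hZ.centered]

theorem integral_simpleIntegral_mul_conj (hZ : IsGaussianRandomMeasure Z Q Γ)
    {s s' : SimpleFunc ℝ ℂ} (hs : s.FinMeasSupp volume) (hs' : s'.FinMeasSupp volume)
    (i j : Fin n) :
    ∫ ω, simpleIntegral Z s ω i * (starRingEnd ℂ) (simpleIntegral Z s' ω j) ∂Q
      = Γ i j * ∫ x, s x * (starRingEnd ℂ) (s' x) := by
  obtain ⟨A, hs1, hA⟩ := exists_simple_representation (Ω := Ω) (n := n) hs
  obtain ⟨B, hs2, hB⟩ := exists_simple_representation (Ω := Ω) (n := n) hs'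
  simp_rw [hA, hB, hs1, hs2, map_sum, map_mul, FinBorel.conj_ind]
  rw [integral_sum_mul_sum _ _ (fun a => hZ.memLp (A a) i) (v := fun b ω => (starRingEnd ℂ) (Z (B b) ω j))
      (fun b => (hZ.memLp (B b) j).star),
    integral_sum_mul_sum _ _ (fun a => (A a).memLp_ind) (fun b => (B b).memLp_ind)]
  simp_rw [hZ.cov, Finset.mul_sum]
  exact Finset.sum_congr rfl fun a _ => Finset.sum_congr rfl fun b _ => by ring

theorem integral_simpleIntegral_mul (hZ : IsGaussianRandomMeasure Z Q Γ)
    {s s' : SimpleFunc ℝ ℂ} (hs : s.FinMeasSupp volume) (hs' : s'.FinMeasSupp volume)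
    (i j : Fin n) :
    ∫ ω, simpleIntegral Z s ω i * simpleIntegral Z s' ω j ∂Q
      = Γ i j * ∫ x, s x * s' (-x) := by
  obtain ⟨A, hs1, hA⟩ := exists_simple_representation (Ω := Ω) (n := n) hs
  obtain ⟨B, hs2, hB⟩ := exists_simple_representation (Ω := Ω) (n := n) hs'
  simp_rw [hA, hB, hs1, hs2]
  rw [integral_sum_mul_sum _ _ (fun a => hZ.memLp (A a) i) (fun b => hZ.memLp (B b) j),
    integral_sum_mul_sum _ _ (fun a => (A a).memLp_ind) (v := fun b x => (B b).ind (-x))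
      (fun b => (B b).neg.memLp_ind)]
  simp_rw [hZ.pseudoCov, Finset.mul_sum]
  exact Finset.sum_congr rfl fun a _ => Finset.sum_congr rfl fun b _ => by ring

theorem isGaussianProcess_re_simpleIntegral {T : Type*} (hZ : IsGaussianRandomMeasure Z Q Γ)
    {s : T → SimpleFunc ℝ ℂ} (hs : ∀ t, (s t).FinMeasSupp volume) :
    IsGaussianProcess (fun (p : T × Fin n) ω => (simpleIntegral Z (s p.1) ω p.2).re) Q := by
  choose A _ hA using fun t => exists_simple_representation (Ω := Ω) (n := n) (hs t)
  -- `Re (a z) = Re a * Re z - Im a * Im z`; the Boolean selects one of the two terms.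
  refine hZ.gaussian.of_finset_sum (κ := ℂ × Bool) (fun p => (s p.1).range ×ˢ Finset.univ)
    (fun p k => if k.2 then k.1.re else -k.1.im)
    (fun p k => if k.2 then Sum.inl (A p.1 k.1, p.2) else Sum.inr (A p.1 k.1, p.2)) fun p ω => ?_
  rw [hA, Complex.re_sum, Finset.sum_product]
  refine Finset.sum_congr rfl fun a _ => ?_
  simp
  ring

end IsGaussianRandomMeasure

end OBM

/-! ### Wiener integrals as `L²` limits. -/

theorem norm_sub_sq_eq_inner {E : Type*} [NormedAddCommGroup E] [InnerProductSpace ℂ E] (u v : E) :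
    ((‖u - v‖ : ℂ)) ^ 2 = inner ℂ u u - inner ℂ u v - inner ℂ v u + inner ℂ v v := by
  refine (inner_self_eq_norm_sq_to_K (𝕜 := ℂ) (u - v)).symm.trans ?_
  rw [inner_sub_left, inner_sub_right, inner_sub_right]
  ring

theorem tendsto_eLpNorm_star_sub_star {α : Type*} [MeasurableSpace α] {μ : Measure α}
    {F : ℕ → α → ℂ} {u : α → ℂ} (h : Tendsto (fun k => eLpNorm (F k - u) 2 μ) atTop (𝓝 0)) :
    Tendsto (fun k => eLpNorm (star (F k) - star u) 2 μ) atTop (𝓝 0) := by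
  refine h.congr fun k => eLpNorm_congr_norm_ae (ae_of_all _ fun x => ?_)
  simp only [Pi.sub_apply, Pi.star_apply, ← star_sub, norm_star]

namespace OBM

variable {Ω : Type*} [MeasurableSpace Ω] {Q : Measure Ω} {n : ℕ}

namespace IsGaussianRandomMeasure

variable {Z : Set ℝ → Ω → Fin n → ℂ} {Γ : Matrix (Fin n) (Fin n) ℝ}

theorem inner_toLp_simpleIntegral (hZ : IsGaussianRandomMeasure Z Q Γ)
    {s s' : SimpleFunc ℝ ℂ} (hs : s.FinMeasSupp volume) (hs' : s'.FinMeasSupp volume)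
    (hm : MemLp s 2 volume) (hm' : MemLp s' 2 volume) (i : Fin n) :
    inner ℂ ((hZ.memLp_simpleIntegral hs' i).toLp _) ((hZ.memLp_simpleIntegral hs i).toLp _)
      = Γ i i * inner ℂ (hm'.toLp s') (hm.toLp s) := by
  rw [L2.inner_def, L2.inner_def]
  have e1 : ∫ ω, inner ℂ ((hZ.memLp_simpleIntegral hs' i).toLp _ ω)
      ((hZ.memLp_simpleIntegral hs i).toLp _ ω) ∂Q
      = ∫ ω, simpleIntegral Z s ω i * (starRingEnd ℂ) (simpleIntegral Z s' ω i) ∂Q := by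
    refine integral_congr_ae ?_
    filter_upwards [(hZ.memLp_simpleIntegral hs' i).coeFn_toLp,
      (hZ.memLp_simpleIntegral hs i).coeFn_toLp] with ω h1 h2
    rw [h1, h2]
    rfl
  have e2 : ∫ x, inner ℂ (hm'.toLp s' x) (hm.toLp s x) = ∫ x, s x * (starRingEnd ℂ) (s' x) := by
    refine integral_congr_ae ?_
    filter_upwards [hm'.coeFn_toLp, hm.coeFn_toLp] with x h1 h2
    rw [h1, h2]
    rfl
  rw [e1, e2, hZ.integral_simpleIntegral_mul_conj hs hs']

/-- This Itô isometry, up to the factor `Γ i i`, turns Cauchy sequences of simple functions into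
Cauchy sequences of integrals. -/
theorem dist_toLp_simpleIntegral (hZ : IsGaussianRandomMeasure Z Q Γ)
    {s s' : SimpleFunc ℝ ℂ} (hs : s.FinMeasSupp volume) (hs' : s'.FinMeasSupp volume)
    (hm : MemLp s 2 volume) (hm' : MemLp s' 2 volume) (i : Fin n) :
    dist ((hZ.memLp_simpleIntegral hs i).toLp _) ((hZ.memLp_simpleIntegral hs' i).toLp _) ^ 2
      = Γ i i * dist (hm.toLp s) (hm'.toLp s') ^ 2 := by
  simp only [dist_eq_norm]
  rw [← Complex.ofReal_inj]
  push_cast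
  rw [norm_sub_sq_eq_inner, norm_sub_sq_eq_inner, hZ.inner_toLp_simpleIntegral hs hs hm hm, hZ.inner_toLp_simpleIntegral hs' hs hm' hm,
    hZ.inner_toLp_simpleIntegral hs hs' hm hm', hZ.inner_toLp_simpleIntegral hs' hs' hm' hm']
  ring

theorem exists_isWienerIntegral (hZ : IsGaussianRandomMeasure Z Q Γ) {f : ℝ → ℂ}
    (hf : MemLp f 2 volume) : ∃ Y, IsWienerIntegral Z Q f Y := by
  have hex : ∀ k : ℕ, ∃ g : SimpleFunc ℝ ℂ,
      eLpNorm (f - ⇑g) 2 volume < ((k : ℝ≥0∞) + 1)⁻¹ ∧ MemLp g 2 volume := fun k =>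
    hf.exists_simpleFunc_eLpNorm_sub_lt (by norm_num) (by simp)
  choose s hs hm using hex
  have hfin : ∀ k, (s k).FinMeasSupp volume := fun k =>
    (SimpleFunc.memLp_iff_finMeasSupp (by norm_num) (by norm_num)).1 (hm k)
  have hlim : Tendsto (fun k => eLpNorm (fun x => s k x - f x) 2 volume) atTop (𝓝 0) := by
    refine tendsto_of_tendsto_of_tendsto_of_le_of_le tendsto_const_nhds
      (h := fun k : ℕ => ((k : ℝ≥0∞) + 1)⁻¹) ?_ (fun _ => zero_le) fun k => ?_
    · have := (tendsto_add_atTop_iff_nat 1).2 ENNReal.tendsto_inv_nat_nhds_zero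
      simpa using this
    · have := eLpNorm_sub_comm (s k) f 2 volume
      exact (this.trans_lt (hs k)).le
  have hcs : CauchySeq fun k => (hm k).toLp (s k) :=
    ((Lp.tendsto_Lp_iff_tendsto_eLpNorm'' _ hm _ hf).2 hlim).cauchySeq
  have hcv : ∀ i, CauchySeq fun k => (hZ.memLp_simpleIntegral (hfin k) i).toLp _ := by
    intro i
    rw [Metric.cauchySeq_iff'] at hcs ⊢
    intro ε hε
    -- The `+ 1` avoids division by zero and lets `Γ i i ≤ (|Γ i i| + 1)²` absorb the isometry
    -- factor.
    obtain ⟨N, hN⟩ := hcs (ε / (|Γ i i| + 1)) (by positivity)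
    refine ⟨N, fun k hk => ?_⟩
    have h1 := hN k hk
    rw [lt_div_iff₀ (by positivity)] at h1
    refine lt_of_le_of_lt ?_ h1
    refine abs_le_of_sq_le_sq' ?_ (by positivity) |>.2
    rw [hZ.dist_toLp_simpleIntegral (hfin k) (hfin N) (hm k) (hm N), mul_pow, mul_comm]
    refine mul_le_mul_of_nonneg_left ?_ (by positivity)
    nlinarith [le_abs_self (Γ i i), abs_nonneg (Γ i i)]
  choose y hy using fun i => cauchySeq_tendsto_of_complete (hcv i)
  refine ⟨fun ω i => y i ω, hf, MemLp.of_eval fun i => Lp.memLp (y i), s, hfin, hlim, ?_⟩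
  have hcomp : ∀ i, Tendsto (fun k => eLpNorm (fun ω => simpleIntegral Z (s k) ω i - y i ω) 2 Q)
      atTop (𝓝 0) := by
    intro i
    have hyi := hy i
    rw [← Lp.toLp_coeFn (y i) (Lp.memLp (y i))] at hyi
    exact (Lp.tendsto_Lp_iff_tendsto_eLpNorm'' _ (fun k => hZ.memLp_simpleIntegral (hfin k) i) _
      (Lp.memLp (y i))).1 hyi
  refine tendsto_of_tendsto_of_tendsto_of_le_of_le tendsto_const_nhds
    (h := fun k => ∑ i, eLpNorm (fun ω => simpleIntegral Z (s k) ω i - y i ω) 2 Q) ?_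
    (fun _ => zero_le) fun k => ?_
  · simpa using tendsto_finsetSum Finset.univ fun i _ => hcomp i
  · exact eLpNorm_pi_le_sum fun i =>
      ((hZ.memLp_simpleIntegral (hfin k) i).sub (Lp.memLp (y i))).aestronglyMeasurable

theorem isWienerIntegral_wienerIntegral (hZ : IsGaussianRandomMeasure Z Q Γ) {f : ℝ → ℂ}
    (hf : MemLp f 2 volume) : IsWienerIntegral Z Q f (wienerIntegral Z Q f) := by
  have h := hZ.exists_isWienerIntegral hf
  rw [wienerIntegral, dif_pos h]
  exact h.choose_spec

end IsGaussianRandomMeasure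

theorem IsWienerIntegral.memLp_eval {Z : Set ℝ → Ω → Fin n → ℂ} {f : ℝ → ℂ} {Y : Ω → Fin n → ℂ}
    (h : IsWienerIntegral Z Q f Y) (i : Fin n) : MemLp (fun ω => Y ω i) 2 Q :=
  h.2.1.eval i

theorem IsWienerIntegral.exists_seq {Z : Set ℝ → Ω → Fin n → ℂ} {f : ℝ → ℂ} {Y : Ω → Fin n → ℂ}
    (h : IsWienerIntegral Z Q f Y) : ∃ s : ℕ → SimpleFunc ℝ ℂ,
      (∀ k, (s k).FinMeasSupp volume) ∧ (∀ k, MemLp (s k) 2 volume) ∧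
      Tendsto (fun k => eLpNorm (⇑(s k) - f) 2 volume) atTop (𝓝 0) ∧
      ∀ i, Tendsto (fun k => eLpNorm ((fun ω => simpleIntegral Z (s k) ω i) - fun ω => Y ω i) 2 Q)
        atTop (𝓝 0) := by
  obtain ⟨-, -, s, hs, h1, h2⟩ := h
  refine ⟨s, hs, fun k => (SimpleFunc.memLp_iff_finMeasSupp (by norm_num) (by norm_num)).2 (hs k),
    h1, fun i => ?_⟩
  exact tendsto_of_tendsto_of_tendsto_of_le_of_le tendsto_const_nhds h2 (fun _ => zero_le)
    fun k => eLpNorm_eval_le (fun ω => simpleIntegral Z (s k) ω - Y ω) i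

namespace IsWienerIntegral

variable {Z : Set ℝ → Ω → Fin n → ℂ} {Γ : Matrix (Fin n) (Fin n) ℝ} {f g : ℝ → ℂ}
  {Y V : Ω → Fin n → ℂ}

theorem integral_eq_zero (h : IsWienerIntegral Z Q f Y) (hZ : IsGaussianRandomMeasure Z Q Γ)
    (i : Fin n) : ∫ ω, Y ω i ∂Q = 0 := by
  have : IsProbabilityMeasure Q := hZ.gaussian.isProbabilityMeasure
  obtain ⟨s, hs, -, -, h2⟩ := h.exists_seq
  have := tendsto_integral_of_tendsto_eLpNorm_two
    (fun k => hZ.memLp_simpleIntegral (hs k) i) (h.memLp_eval i) (h2 i)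
  simp_rw [fun k => hZ.integral_simpleIntegral (hs k) i] at this
  exact tendsto_nhds_unique this tendsto_const_nhds

theorem integral_mul_conj (hY : IsWienerIntegral Z Q f Y) (hV : IsWienerIntegral Z Q g V)
    (hZ : IsGaussianRandomMeasure Z Q Γ) (i j : Fin n) :
    ∫ ω, Y ω i * (starRingEnd ℂ) (V ω j) ∂Q = Γ i j * ∫ x, f x * (starRingEnd ℂ) (g x) := by
  obtain ⟨s, hs, hsm, hs1, hs2⟩ := hY.exists_seq
  obtain ⟨r, hr, hrm, hr1, hr2⟩ := hV.exists_seq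
  have h1 := tendsto_integral_mul_of_tendsto_eLpNorm
    (fun k => hZ.memLp_simpleIntegral (hs k) i) (hY.memLp_eval i)
    (fun k => (hZ.memLp_simpleIntegral (hr k) j).star) (hV.memLp_eval j).star (hs2 i)
    (tendsto_eLpNorm_star_sub_star (hr2 j))
  have h2 := tendsto_integral_mul_of_tendsto_eLpNorm hsm hY.1 (fun k => (hrm k).star) hV.1.star hs1
    (tendsto_eLpNorm_star_sub_star hr1)
  refine tendsto_nhds_unique h1 ((h2.const_mul (Γ i j : ℂ)).congr fun k => ?_)
  exact (hZ.integral_simpleIntegral_mul_conj (hs k) (hr k) i j).symm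

/-- Reflection preserves Lebesgue measure, so the reflected simple functions also converge in `L²`
and the identity for simple functions passes to the limit. -/
theorem integral_mul (hY : IsWienerIntegral Z Q f Y) (hV : IsWienerIntegral Z Q g V)
    (hZ : IsGaussianRandomMeasure Z Q Γ) (i j : Fin n) :
    ∫ ω, Y ω i * V ω j ∂Q = Γ i j * ∫ x, f x * g (-x) := by
  have hneg := Measure.measurePreserving_neg (volume : Measure ℝ)
  obtain ⟨s, hs, hsm, hs1, hs2⟩ := hY.exists_seq
  obtain ⟨r, hr, hrm, hr1, hr2⟩ := hV.exists_seq
  have h1 := tendsto_integral_mul_of_tendsto_eLpNorm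
    (fun k => hZ.memLp_simpleIntegral (hs k) i) (hY.memLp_eval i)
    (fun k => hZ.memLp_simpleIntegral (hr k) j) (hV.memLp_eval j) (hs2 i) (hr2 j)
  have h2 := tendsto_integral_mul_of_tendsto_eLpNorm hsm hY.1
    (fun k => (hrm k).comp_measurePreserving hneg) (hV.1.comp_measurePreserving hneg) hs1
    (hr1.congr fun k => (eLpNorm_comp_measurePreserving
      ((hrm k).sub hV.1).aestronglyMeasurable hneg).symm)
  refine tendsto_nhds_unique h1 ((h2.const_mul (Γ i j : ℂ)).congr fun k => ?_)
  exact (hZ.integral_simpleIntegral_mul (hs k) (hr k) i j).symm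

/-- The integral of a Hermitian function is almost surely real. -/
theorem im_ae_eq_zero (hY : IsWienerIntegral Z Q f Y) (hZ : IsGaussianRandomMeasure Z Q Γ)
    (hf : ∀ x, f (-x) = (starRingEnd ℂ) (f x)) (i : Fin n) : ∀ᵐ ω ∂Q, (Y ω i).im = 0 := by
  have h1 := hY.integral_mul_conj hY hZ i i
  have h2 := hY.integral_mul hY hZ i i
  simp_rw [hf] at h2
  rw [← h1] at h2
  have hi1 : Integrable (fun ω => Y ω i * (starRingEnd ℂ) (Y ω i)) Q :=
    (hY.memLp_eval i).integrable_mul (hY.memLp_eval i).star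
  have hi2 : Integrable (fun ω => Y ω i * Y ω i) Q :=
    (hY.memLp_eval i).integrable_mul (hY.memLp_eval i)
  -- The integrand has real part `2 (Im Y)²`, while Hermitian symmetry makes `E |Y|²` and `E Y²`
  -- equal.
  have h3 : ∫ ω, (Y ω i * (starRingEnd ℂ) (Y ω i) - Y ω i * Y ω i) ∂Q = 0 := by
    rw [integral_sub hi1 hi2, h2, sub_self]
  have hi : Integrable (fun ω => Y ω i * (starRingEnd ℂ) (Y ω i) - Y ω i * Y ω i) Q := hi1.sub hi2
  have h4 : ∫ ω, 2 * (Y ω i).im ^ 2 ∂Q = 0 := by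
    have := congrArg Complex.re h3
    rw [← RCLike.re_eq_complex_re, ← integral_re hi] at this
    refine Eq.trans (integral_congr_ae (ae_of_all _ fun ω => ?_)) this
    simp
    ring
  have hint : Integrable (fun ω => 2 * (Y ω i).im ^ 2) Q := by
    refine hi.re.congr (ae_of_all _ fun ω => ?_)
    simp
    ring
  rw [integral_eq_zero_iff_of_nonneg (fun ω => by positivity) hint] at h4
  filter_upwards [h4] with ω hω
  simpa using hω

/-- Once `Y` is real, `Re (Y * conj V) = Re Y * Re V`; hence only `f` has to be Hermitian. -/
theorem integral_re_mul_re (hY : IsWienerIntegral Z Q f Y) (hV : IsWienerIntegral Z Q g V)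
    (hZ : IsGaussianRandomMeasure Z Q Γ) (hf : ∀ x, f (-x) = (starRingEnd ℂ) (f x))
    (i j : Fin n) : ∫ ω, (Y ω i).re * (V ω j).re ∂Q
      = Γ i j * (∫ x, f x * (starRingEnd ℂ) (g x)).re := by
  have h := congrArg Complex.re (hY.integral_mul_conj hV hZ i j)
  have hi : Integrable (fun ω => Y ω i * (starRingEnd ℂ) (V ω j)) Q :=
    (hY.memLp_eval i).integrable_mul (hV.memLp_eval j).star
  rw [Complex.re_ofReal_mul, ← RCLike.re_eq_complex_re, ← integral_re hi] at h
  rw [← RCLike.re_eq_complex_re, ← h]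
  refine integral_congr_ae ?_
  filter_upwards [hY.im_ae_eq_zero hZ hf i] with ω hω
  simp [hω]

theorem isGaussianProcess_re {T : Type*} {f : T → ℝ → ℂ} {Y : T → Ω → Fin n → ℂ}
    (hY : ∀ t, IsWienerIntegral Z Q (f t) (Y t)) (hZ : IsGaussianRandomMeasure Z Q Γ) :
    IsGaussianProcess (fun (p : T × Fin n) ω => (Y p.1 ω p.2).re) Q := by
  have : IsProbabilityMeasure Q := hZ.gaussian.isProbabilityMeasure
  choose s hs _ _ h2 using fun t => (hY t).exists_seq
  refine IsGaussianProcess.of_tendsto_eLpNorm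
    (Y := fun k (p : T × Fin n) ω => (simpleIntegral Z (s p.1 k) ω p.2).re)
    (fun k => hZ.isGaussianProcess_re_simpleIntegral fun t => hs t k)
    (fun p => ((hY p.1).memLp_eval p.2).re) fun p => ?_
  refine tendsto_of_tendsto_of_tendsto_of_le_of_le tendsto_const_nhds (h2 p.1 p.2)
    (fun _ => zero_le) fun k => eLpNorm_mono fun ω => ?_
  simp only [Pi.sub_apply, ← Complex.sub_re]
  exact Complex.abs_re_le_norm _

end IsWienerIntegral

/-- The normalized spectral integral is a real Gaussian process with the law of an operator
Brownian motion of covariance matrix `Γ`. -/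
theorem eqLaw_spectral {Ω' : Type*} [MeasurableSpace Ω'] {P : Measure Ω'}
    {X : ℝ → Ω' → Fin n → ℝ} {Z : Set ℝ → Ω → Fin n → ℂ} {Γ : Matrix (Fin n) (Fin n) ℝ}
    (hZ : IsGaussianRandomMeasure Z Q Γ)
    (hX : IsGaussianProcess (fun (p : ℝ × Fin n) ω => X p.1 ω p.2) P)
    (hm : ∀ t i, ∫ ω, X t ω i ∂P = 0)
    (hc : ∀ s t i j, cov[fun ω => X s ω i, fun ω => X t ω j; P] = bmCov s t * Γ i j) :
    EqLaw (fun t ω i => ((X t ω i : ℝ) : ℂ)) P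
      (fun t ω => (((Real.sqrt (2 * Real.pi))⁻¹ : ℝ) : ℂ) • wienerIntegral Z Q (kernel t) ω) Q := by
  have hQ : IsProbabilityMeasure Q := hZ.gaussian.isProbabilityMeasure
  set c : ℝ := (Real.sqrt (2 * Real.pi))⁻¹ with hcdef
  have hc2 : c * c * (2 * Real.pi) = 1 := by
    have h2 : 0 < 2 * Real.pi := by positivity
    rw [hcdef, ← mul_inv, Real.mul_self_sqrt h2.le, inv_mul_cancel₀ h2.ne']
  set Y : ℝ → Ω → Fin n → ℂ := fun t => wienerIntegral Z Q (kernel t)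
  have hY : ∀ t, IsWienerIntegral Z Q (kernel t) (Y t) := fun t =>
    hZ.isWienerIntegral_wienerIntegral (memLp_kernel t)
  have hG := (IsWienerIntegral.isGaussianProcess_re hY hZ).smul fun _ => c
  have hmean : ∀ t i, ∫ ω, (Y t ω i).re ∂Q = 0 := fun t i => by
    have h := (hY t).integral_eq_zero hZ i
    have := congrArg Complex.re h
    rwa [← RCLike.re_eq_complex_re, ← integral_re (((hY t).memLp_eval i).integrable (by norm_num))]
      at this
  -- The comparison is made for real parts first; the imaginary parts vanish almost surely and are
  -- restored on each finite set of times.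
  have hmain : EqLaw X P (fun t ω i => c * (Y t ω i).re) Q := by
    refine eqLaw_of_coord hX hG (fun t i => ?_) fun s t i j => ?_
    · rw [hm, integral_const_mul, hmean, mul_zero]
    · have hcov := covariance_eq_sub (X := fun ω => (Y s ω i).re) (Y := fun ω => (Y t ω j).re)
        ((hY s).memLp_eval i).re ((hY t).memLp_eval j).re
      have h := (hY s).integral_re_mul_re (hY t) hZ (kernel_neg s) i j
      rw [re_integral_kernel_mul_conj_kernel] at h
      simp only [Pi.mul_apply] at hcov
      rw [h, hmean, hmean] at hcov
      rw [hc, covariance_const_mul_left, covariance_const_mul_right, hcov]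
      linear_combination (-(bmCov s t * Γ i j)) * hc2
  intro I
  have hcx := (hmain I).comp (u := fun (x : I → Fin n → ℝ) (t : I) (i : Fin n) => ((x t i : ℝ) : ℂ))
    (by fun_prop)
  refine hcx.trans (IdentDistrib.of_ae_eq hcx.aemeasurable_snd ?_)
  have hre : ∀ᵐ ω ∂Q, ∀ (t : I) (i : Fin n), (Y t ω i).im = 0 := by
    rw [ae_all_iff]
    intro t
    rw [ae_all_iff]
    exact fun i => (hY t).im_ae_eq_zero hZ (kernel_neg t) i
  filter_upwards [hre] with ω hω
  ext t i
  have him : (wienerIntegral Z Q (kernel t) ω i).im = 0 := hω t i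
  apply Complex.ext <;> simp [Y, him]

end OBM

/-! ### Existence of isonormal processes and white noise. -/

/-- Pass through `ℓ²`: coordinates in `b`, followed by synthesis along `v`, which need not span `E`.
-/
theorem HilbertBasis.exists_linearIsometry {ι H E : Type*} [NormedAddCommGroup H]
    [InnerProductSpace ℝ H] [NormedAddCommGroup E] [InnerProductSpace ℝ E] [CompleteSpace E]
    (b : HilbertBasis ι ℝ H) {v : ι → E} (hv : Orthonormal ℝ v) :
    ∃ Φ : H →ₗᵢ[ℝ] E, ∀ i, Φ (b i) = v i := by
  classical
  refine ⟨hv.orthogonalFamily.linearIsometry.comp b.repr.toLinearIsometry, fun i => ?_⟩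
  have h : hv.orthogonalFamily.linearIsometry (b.repr (b i)) = v i := by
    rw [b.repr_self, OrthogonalFamily.linearIsometry_apply_single]
    simp
  exact h

theorem coeFn_sum_smul_toLp {α ι : Type*} [MeasurableSpace α] {μ : Measure α} (s : Finset ι)
    (c : ι → ℝ) {ξ : ι → α → ℝ} (hξ : ∀ i, MemLp (ξ i) 2 μ) :
    ⇑(∑ i ∈ s, c i • (hξ i).toLp (ξ i)) =ᵐ[μ] fun x => ∑ i ∈ s, c i * ξ i x := by
  have h1 : ∀ᵐ x ∂μ, ∀ i ∈ s, (c i • (hξ i).toLp (ξ i) : Lp ℝ 2 μ) x = c i * ξ i x :=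
    (Finset.eventually_all s).2 fun i _ => by
      filter_upwards [Lp.coeFn_smul (c i) ((hξ i).toLp (ξ i)), (hξ i).coeFn_toLp] with x h1 h2
      simp [h1, h2]
  filter_upwards [Lp.coeFn_finsetSum s fun i => c i • (hξ i).toLp (ξ i), h1] with x h2 h3
  rw [h2, Finset.sum_apply]
  exact Finset.sum_congr rfl h3

namespace OBM

/-- Existence of the isonormal Gaussian process over a real Hilbert space. -/
theorem exists_isonormal (H : Type) [NormedAddCommGroup H] [InnerProductSpace ℝ H]
    [CompleteSpace H] :
    ∃ (Ω : Type) (_ : MeasurableSpace Ω) (Q : Measure Ω) (_ : IsProbabilityMeasure Q)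
      (N : H → Ω → ℝ), IsGaussianProcess N Q ∧ (∀ h, ∫ ω, N h ω ∂Q = 0) ∧
        ∀ h k, cov[N h, N k; Q] = inner ℝ h k := by
  obtain ⟨w, b, -⟩ := exists_hilbertBasis ℝ H
  obtain ⟨Ω, mΩ, Q, ξ, -, hlaw, hind, hQ⟩ := exists_iid w (gaussianReal 0 1)
  have hξ2 : ∀ i, MemLp (ξ i) 2 Q := fun i => (hlaw i).hasGaussianLaw.memLp_two
  have hξ0 : ∀ i, ∫ ω, ξ i ω ∂Q = 0 := fun i => by
    rw [(hlaw i).integral_eq, integral_id_gaussianReal]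
  have hξG : IsGaussianProcess ξ Q :=
    ⟨fun I => iIndepFun.hasGaussianLaw (fun i : I => (hlaw i).hasGaussianLaw)
      (hind.precomp Subtype.val_injective)⟩
  have hv : Orthonormal ℝ fun i => (hξ2 i).toLp (ξ i) := by
    classical
    rw [orthonormal_iff_ite]
    intro i j
    have hin : inner ℝ ((hξ2 i).toLp (ξ i)) ((hξ2 j).toLp (ξ j)) = ∫ ω, ξ j ω * ξ i ω ∂Q := by
      rw [L2.inner_def]
      refine integral_congr_ae ?_
      filter_upwards [(hξ2 i).coeFn_toLp, (hξ2 j).coeFn_toLp] with ω h1 h2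
      rw [h1, h2]
      rfl
    have hcov := covariance_eq_sub (hξ2 j) (hξ2 i)
    rw [hξ0, zero_mul, sub_zero] at hcov
    refine hin.trans (hcov.symm.trans ?_)
    split_ifs with hij
    · subst hij
      rw [covariance_self (hξ2 i).aemeasurable, (hlaw i).variance_eq, variance_id_gaussianReal]
      rfl
    · exact (hind.indepFun (Ne.symm hij)).covariance_eq_zero (hξ2 j) (hξ2 i)
  -- The process is `h ↦ Φ h`: its covariance is the inner product because `Φ` is isometric, and it
  -- is Gaussian as an `L²` limit of finite combinations of the `ξ i`.
  obtain ⟨Φ, hΦb⟩ := b.exists_linearIsometry hv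
  have hspan : ∀ h ∈ Submodule.span ℝ (Set.range b), ∃ c : w →₀ ℝ,
      Φ h =ᵐ[Q] fun ω => ∑ i ∈ c.support, c i * ξ i ω := by
    intro h hh
    obtain ⟨c, rfl⟩ := Finsupp.mem_span_range_iff_exists_finsupp.1 hh
    refine ⟨c, ?_⟩
    have e : Φ (c.sum fun i a => a • b i) = ∑ i ∈ c.support, c i • (hξ2 i).toLp (ξ i) := by
      rw [Finsupp.sum, map_sum]
      exact Finset.sum_congr rfl fun i _ => by rw [map_smul, hΦb]
    rw [e]
    exact coeFn_sum_smul_toLp _ _ hξ2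
  have happrox : ∀ h : H, ∃ x : ℕ → H, (∀ k, x k ∈ Submodule.span ℝ (Set.range b)) ∧
      Tendsto x atTop (𝓝 h) := fun h => by
    have hd : h ∈ closure (Submodule.span ℝ (Set.range b) : Set H) := by
      have := b.dense_span
      rw [← Submodule.topologicalClosure_coe, this]
      trivial
    exact mem_closure_iff_seq_limit.1 hd
  choose x hx hxlim using happrox
  choose c hc using fun h k => hspan (x h k) (hx h k)
  set F : ℕ → H → Ω → ℝ := fun k h ω => ∑ i ∈ (c h k).support, c h k i * ξ i ω with hF
  have hF2 : ∀ k h, MemLp (F k h) 2 Q := fun k h =>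
    memLp_finsetSum (c h k).support fun i _ => (hξ2 i).const_mul (c h k i)
  have hlim : ∀ h, Tendsto (fun k => eLpNorm (F k h - ⇑(Φ h)) 2 Q) atTop (𝓝 0) := fun h => by
    have h1 := (Lp.tendsto_Lp_iff_tendsto_eLpNorm' _ _).1
      ((Φ.continuous.tendsto h).comp (hxlim h))
    refine h1.congr fun k => eLpNorm_congr_ae ?_
    exact (hc h k).sub ae_eq_rfl
  have hmean : ∀ h, ∫ ω, Φ h ω ∂Q = 0 := fun h => by
    have h1 := tendsto_integral_of_tendsto_eLpNorm_two (fun k => hF2 k h) (Lp.memLp (Φ h)) (hlim h)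
    refine tendsto_nhds_unique h1 (tendsto_const_nhds.congr fun k => ?_)
    simp only [hF]
    rw [integral_finsetSum _ fun i _ => ((hξ2 i).integrable (by norm_num)).const_mul _]
    simp [integral_const_mul, hξ0]
  refine ⟨Ω, mΩ, Q, hQ, fun h => Φ h, ?_, hmean, fun h k => ?_⟩
  · exact IsGaussianProcess.of_tendsto_eLpNorm
      (fun k => hξG.of_finset_sum (fun h => (c h k).support) (fun h => c h k) (fun _ i => i)
        fun _ _ => rfl) (fun h => Lp.memLp (Φ h)) hlim
  · rw [covariance_eq_sub (Lp.memLp _) (Lp.memLp _), hmean, zero_mul, sub_zero, ← Φ.inner_map_map,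
      L2.inner_def]
    exact integral_congr_ae (ae_of_all _ fun ω => mul_comm _ _)

/-- Existence of finitely many independent real white noises on `ℝ`. -/
theorem exists_whiteNoise (ι : Type) [Fintype ι] [DecidableEq ι] :
    ∃ (Ω : Type) (_ : MeasurableSpace Ω) (Q : Measure Ω) (_ : IsProbabilityMeasure Q)
      (N : ι × FinBorel → Ω → ℝ), IsGaussianProcess N Q ∧ (∀ p, ∫ ω, N p ω ∂Q = 0) ∧
        ∀ p q, cov[N p, N q; Q] =
          if p.1 = q.1 then volume.real ((p.2 : Set ℝ) ∩ q.2) else 0 := by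
  obtain ⟨Ω, mΩ, Q, hQ, N, hG, hm, hc⟩ :=
    -- One copy of `L²(ℝ)` per index; distinct summands are orthogonal, so the noises are
    -- uncorrelated.
    exists_isonormal (PiLp 2 fun _ : ι => Lp ℝ 2 (volume : Measure ℝ))
  refine ⟨Ω, mΩ, Q, hQ, fun p => N (WithLp.toLp 2
    (Pi.single p.1 (indicatorConstLp 2 p.2.2.1 p.2.2.2.ne (1 : ℝ)))), hG.comp_right _,
    fun p => hm _, fun p q => ?_⟩
  rw [hc, PiLp.inner_apply, Finset.sum_eq_single p.1]
  · simp only [Pi.single_eq_same]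
    split_ifs with h
    · rw [h, Pi.single_eq_same, L2.real_inner_indicatorConstLp_one_indicatorConstLp_one p.2.2.1 q.2.2.1
        p.2.2.2.ne q.2.2.2.ne]
    · rw [Pi.single_eq_of_ne h, inner_zero_right]
  · intro k _ hk
    simp only [Pi.single_eq_of_ne hk, inner_zero_left]
  · simp

end OBM

/-! ### Existence of Brownian motion and of the Hermitian Gaussian measure. -/

namespace OBM

variable {Ω : Type*} [MeasurableSpace Ω] {Q : Measure Ω} {n : ℕ}

/-- Times of opposite signs give disjoint intervals, so `B t` can be the noise of `uIoc 0 t` with no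
sign for `t < 0`. -/
theorem volume_real_uIoc_inter_uIoc (s t : ℝ) :
    volume.real (Set.uIoc 0 s ∩ Set.uIoc 0 t) = bmCov s t := by
  rw [Set.uIoc, Set.uIoc, Set.Ioc_inter_Ioc, measureReal_def, Real.volume_Ioc, bmCov]
  rcases le_total 0 s with hs | hs <;> rcases le_total 0 t with ht | ht <;>
    rcases le_total s t with hst | hst <;>
    simp only [hs, ht, hst, max_self, min_self, max_eq_left, max_eq_right, min_eq_left,
      min_eq_right, abs_of_nonneg, abs_of_nonpos, sub_nonneg, sub_nonpos] <;>
    rw [ENNReal.toReal_ofReal (by linarith)] <;> linarith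

theorem bmCov_increments_eq_zero {r s u v : ℝ} (hrs : r ≤ s) (hsu : s ≤ u) (huv : u ≤ v) :
    bmCov s v - bmCov s u - bmCov r v + bmCov r u = 0 := by
  simp only [bmCov]
  rw [abs_of_nonneg (by linarith : 0 ≤ v - s), abs_of_nonneg (by linarith : 0 ≤ u - s),
    abs_of_nonneg (by linarith : 0 ≤ v - r), abs_of_nonneg (by linarith : 0 ≤ u - r)]
  ring

/-- A centred Gaussian process with the covariance of Brownian motion is a Brownian motion. -/
theorem isStandardBM_of_covariance {b : ℝ → Ω → ℝ} (hG : IsGaussianProcess b Q)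
    (hm : ∀ t, ∫ ω, b t ω ∂Q = 0) (hc : ∀ s t, cov[b s, b t; Q] = bmCov s t) :
    IsStandardBM b Q where
  zero := by
    have hQ := hG.isProbabilityMeasure
    have h2 := (hG.hasGaussianLaw_eval 0).memLp_two
    have hv : Var[b 0; Q] = 0 := by
      rw [← covariance_self h2.aemeasurable, hc]
      simp [bmCov]
    have := ae_eq_integral_of_variance_eq_zero h2 hv
    rwa [hm] at this
  indep_increments m t ht := by
    have hQ := hG.isProbabilityMeasure
    -- Jointly Gaussian increments are independent as soon as they are uncorrelated.
    refine hG.hasGaussianLaw_increments.iIndepFun_of_covariance_eq_zero fun i j hij => ?_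
    have h2 := fun t => (hG.hasGaussianLaw_eval t).memLp_two
    rw [covariance_fun_sub_fun_sub (h2 _) (h2 _) (h2 _) (h2 _)]
    simp_rw [hc]
    rcases lt_or_gt_of_ne hij with h | h
    · exact bmCov_increments_eq_zero (ht (Fin.castSucc_le_succ i))
        (ht (Fin.succ_le_castSucc_iff.2 h)) (ht (Fin.castSucc_le_succ j))
    · have := bmCov_increments_eq_zero (ht (Fin.castSucc_le_succ j))
        (ht (Fin.succ_le_castSucc_iff.2 h)) (ht (Fin.castSucc_le_succ i))
      simp only [bmCov_comm (t _) (t j.succ), bmCov_comm (t _) (t j.castSucc)] at this ⊢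
      linarith
  law_increment s t := by
    have hQ := hG.isProbabilityMeasure
    have h2 := fun t => (hG.hasGaussianLaw_eval t).memLp_two
    have hd : HasGaussianLaw (fun ω => b t ω - b s ω) Q := hG.hasGaussianLaw_fun_sub
    refine ⟨hd.aemeasurable, ?_⟩
    rw [hd.map_eq_gaussianReal, integral_sub ((h2 t).integrable (by norm_num))
      ((h2 s).integrable (by norm_num)), hm, hm, sub_zero, ← covariance_self hd.aemeasurable,
      covariance_fun_sub_fun_sub (h2 _) (h2 _) (h2 _) (h2 _)]
    simp_rw [hc]
    have e : bmCov t t - bmCov t s - bmCov s t + bmCov s s = ((Real.nnabs (t - s) : NNReal) : ℝ) := by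
      simp only [bmCov, Real.coe_nnabs, sub_self, abs_zero, abs_sub_comm s t]
      ring
    rw [e, Real.toNNReal_coe]

/-- Existence of a vector of independent Brownian motions. -/
theorem exists_isStandardBMVector (n : ℕ) :
    ∃ (Ω : Type) (_ : MeasurableSpace Ω) (Q : Measure Ω) (_ : IsProbabilityMeasure Q)
      (B : ℝ → Ω → Fin n → ℝ), IsStandardBMVector B Q := by
  obtain ⟨Ω, mΩ, Q, hQ, N, hG, hm, hc⟩ := exists_whiteNoise (Fin n)
  let A : ℝ → FinBorel := fun t => ⟨Set.uIoc 0 t, measurableSet_uIoc, by simp [Set.uIoc]⟩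
  refine ⟨Ω, mΩ, Q, hQ, fun t ω i => N (i, A t) ω, fun i => ?_, ?_⟩
  · refine isStandardBM_of_covariance (hG.comp_right fun t => (i, A t)) (fun t => hm _)
      fun s t => ?_
    refine (hc (i, A s) (i, A t)).trans ?_
    rw [if_pos rfl]
    exact volume_real_uIoc_inter_uIoc s t
  · refine IsGaussianProcess.iIndepFun_of_covariance_eq_zero (S := fun _ : Fin n => ℝ)
      (X := fun i t => N (i, A t))
      (hG.comp_right fun p : (_ : Fin n) × ℝ => (p.1, A p.2))
      (fun i t => hG.aemeasurable _) fun i j hij s t => ?_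
    rw [hc, if_neg hij]

theorem FinBorel.neg_neg (A : FinBorel) : A.neg.neg = A :=
  Subtype.ext (by ext; simp [FinBorel.neg])

theorem FinBorel.volume_neg_inter (A B : FinBorel) :
    volume.real ((A.neg : Set ℝ) ∩ B) = volume.real ((A : Set ℝ) ∩ B.neg) := by
  have h := (Measure.measurePreserving_neg (volume : Measure ℝ)).measureReal_preimage
    (A.2.1.inter B.neg.2.1).nullMeasurableSet
  rw [← h, Set.preimage_inter]
  congr 2
  exact congrArg Subtype.val B.neg_neg.symm

/-- The Hermitian random measure made of real white noises `N (i, false)`, `N (i, true)`. -/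
noncomputable def hermitize (N : (Fin n × Bool) × FinBorel → Ω → ℝ) (A : FinBorel) (ω : Ω)
    (i : Fin n) : ℂ :=
  ⟨(N ((i, false), A) ω + N ((i, false), A.neg) ω) / 2,
    (N ((i, true), A) ω - N ((i, true), A.neg) ω) / 2⟩

/-- Existence of the Hermitian Gaussian random measure. -/
theorem exists_isHermitianGaussianMeasure (n : ℕ) :
    ∃ (Ω : Type) (_ : MeasurableSpace Ω) (Q : Measure Ω) (_ : IsProbabilityMeasure Q)
      (Z : Set ℝ → Ω → Fin n → ℂ), IsHermitianGaussianMeasure Z Q := by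
  classical
  obtain ⟨Ω, mΩ, Q, hQ, N, hG, hm, hc⟩ := exists_whiteNoise (Fin n × Bool)
  let Z : Set ℝ → Ω → Fin n → ℂ := fun A =>
    if h : MeasurableSet A ∧ volume A < ∞ then hermitize N ⟨A, h⟩ else 0
  have hZ : ∀ A : FinBorel, Z A = hermitize N A := fun A => dif_pos A.2
  have hZneg : ∀ A : FinBorel, Z ((fun x : ℝ => -x) ⁻¹' A) = hermitize N A.neg := fun A =>
    hZ A.neg
  have hN2 : ∀ p, MemLp (N p) 2 Q := fun p => (hG.hasGaussianLaw_eval p).memLp_two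
  have hNN : ∀ p q, ∫ ω, (N p ω : ℂ) * (N q ω : ℂ) ∂Q =
      if p.1 = q.1 then ((volume.real ((p.2 : Set ℝ) ∩ q.2) : ℝ) : ℂ) else 0 := fun p q => by
    have h := covariance_eq_sub (hN2 p) (hN2 q)
    rw [hm, zero_mul, sub_zero, hc] at h
    simp_rw [← Complex.ofReal_mul]
    rw [integral_complex_ofReal]
    refine (congrArg Complex.ofReal h.symm).trans ?_
    split_ifs <;> simp
  -- The first Boolean selects the noise of the imaginary or the real part, the second selects `A`
  -- or `-A`.
  have hrep : ∀ A ω i, hermitize N A ω i = ∑ k : Bool × Bool,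
      (if k.1 then (if k.2 then Complex.I / 2 else -(Complex.I / 2)) else 1 / 2) *
        (N ((i, k.1), if k.2 then A else A.neg) ω : ℂ) := fun A ω i => by
    simp only [Fintype.sum_prod_type, Fintype.sum_bool, hermitize]
    apply Complex.ext <;> simp <;> ring
  have hjoint : IsGaussianProcess (Sum.elim
      (fun (p : FinBorel × Fin n) ω => (hermitize N p.1 ω p.2).re)
      (fun (p : FinBorel × Fin n) ω => (hermitize N p.1 ω p.2).im)) Q := by
    refine hG.of_finset_sum (κ := Bool) (fun _ => Finset.univ)
      (fun s k => s.elim (fun _ => 1 / 2) fun _ => if k then 1 / 2 else -(1 / 2))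
      (fun s k => s.elim (fun p => ((p.2, false), if k then p.1 else p.1.neg))
        fun p => ((p.2, true), if k then p.1 else p.1.neg)) fun s ω => ?_
    rcases s with ⟨A, i⟩ | ⟨A, i⟩ <;> simp [hermitize] <;> ring
  refine ⟨Ω, mΩ, Q, hQ, Z, ?_, ?_, ?_, ?_, ?_, ?_, ?_⟩
  · simp_rw [hZ]
    exact isGaussianProcess_of_coord (hjoint.comp_right Sum.inl)
  · simp_rw [hZ]
    exact isGaussianProcess_of_coord (hjoint.comp_right Sum.inr)
  · simp_rw [hZ]
    have hind := hjoint.indepFun_of_covariance_eq_zero (fun p => hjoint.aemeasurable (Sum.inl p))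
      (fun p => hjoint.aemeasurable (Sum.inr p)) fun p q => by
        have e1 : (fun ω => (hermitize N p.1 ω p.2).re)
            = fun ω => (N ((p.2, false), p.1) + N ((p.2, false), p.1.neg)) ω / 2 := rfl
        have e2 : (fun ω => (hermitize N q.1 ω q.2).im)
            = fun ω => (N ((q.2, true), q.1) - N ((q.2, true), q.1.neg)) ω / 2 := rfl
        rw [e1, e2, covariance_fun_div_left, covariance_fun_div_right,
          covariance_add_left (hN2 _) (hN2 _) ((hN2 _).sub (hN2 _)),
          covariance_sub_right (hN2 _) (hN2 _) (hN2 _),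
          covariance_sub_right (hN2 _) (hN2 _) (hN2 _)]
        simp [hc]
    have hmeas : Measurable fun (x : FinBorel × Fin n → ℝ) (A : FinBorel) (i : Fin n) =>
        x (A, i) := by fun_prop
    exact hind.comp hmeas hmeas
  · intro A i
    simp_rw [hZ, hrep]
    rw [integral_finsetSum _ fun k _ => ((hN2 _).integrable (by norm_num)).ofReal.const_mul _]
    refine Finset.sum_eq_zero fun k _ => ?_
    rw [integral_const_mul, integral_complex_ofReal, hm]
    simp
  -- On the diagonal the real parts contribute `(|A ∩ A'| + |A ∩ -A'|) / 2` and the imaginary parts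
  -- `(|A ∩ A'| - |A ∩ -A'|) / 2`; this is why `hermitize` divides by `2`.
  · intro A A' i j
    simp_rw [hZ, hrep, map_sum, map_mul, Complex.conj_ofReal]
    rw [integral_sum_mul_sum Finset.univ Finset.univ
      (u := fun (k : Bool × Bool) ω => (N ((i, k.1), if k.2 then A else A.neg) ω : ℂ))
      (v := fun (k : Bool × Bool) ω => (N ((j, k.1), if k.2 then A' else A'.neg) ω : ℂ))
      (fun k => (hN2 _).ofReal) (fun k => (hN2 _).ofReal)]
    simp_rw [hNN]
    have h1 := A.volume_neg_inter A'
    have h2 := A.volume_neg_inter A'.neg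
    rw [A'.neg_neg] at h2
    by_cases hij : i = j
    · subst hij
      simp only [Fintype.sum_prod_type, Fintype.sum_bool]
      simp [h1, h2]
      ring_nf
      simp only [Complex.I_sq, map_ofNat]
      ring
    · simp [hij]
  · exact fun A => ae_of_all _ fun ω i => by
      rw [hZ, hZneg]
      simp only [hermitize, A.neg_neg]
      rw [add_comm]
  · exact fun A => ae_of_all _ fun ω i => by
      rw [hZ, hZneg]
      simp only [hermitize, A.neg_neg]
      ring

end OBM

/-! ### The representation theorem. -/

theorem proposition7p2 {n : ℕ} {Ω : Type*} [MeasurableSpace Ω] (P : Measure Ω)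
    [IsProbabilityMeasure P] (X : ℝ → Ω → Fin n → ℝ) (hX : OBM.IsOperatorBrownianMotion X P) :
    -- the processes on the right-hand sides exist
    (∃ (Ω₁ : Type) (_ : MeasurableSpace Ω₁) (Q : Measure Ω₁) (_ : IsProbabilityMeasure Q)
      (B : ℝ → Ω₁ → Fin n → ℝ), OBM.IsStandardBMVector B Q) ∧
    (∃ (Ω₂ : Type) (_ : MeasurableSpace Ω₂) (Q : Measure Ω₂) (_ : IsProbabilityMeasure Q)
      (Z : Set ℝ → Ω₂ → Fin n → ℂ), OBM.IsHermitianGaussianMeasure Z Q) ∧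
    ∃ W : Matrix (Fin n) (Fin n) ℝ, W.PosDef ∧
      -- the law of `X` is that of `W B`
      (∀ (Ω₁ : Type*) [MeasurableSpace Ω₁] (Q : Measure Ω₁) [IsProbabilityMeasure Q]
        (B : ℝ → Ω₁ → Fin n → ℝ), OBM.IsStandardBMVector B Q →
        OBM.EqLaw X P (fun t ω => W.mulVec (B t ω)) Q) ∧
      -- the law of `X` is that of the normalized spectral integral
      (∀ (Ω₂ : Type*) [MeasurableSpace Ω₂] (Q : Measure Ω₂) [IsProbabilityMeasure Q]
        (Z : Set ℝ → Ω₂ → Fin n → ℂ), OBM.IsHermitianGaussianMeasure Z Q →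
        OBM.EqLaw (fun t ω i => ((X t ω i : ℝ) : ℂ)) P
          (fun t ω => (((Real.sqrt (2 * Real.pi))⁻¹ : ℝ) : ℂ) •
            OBM.wienerIntegral (OBM.matMeasure W Z) Q (OBM.kernel t) ω) Q) := by

  have hΓ := hX.covMat_posDef
  obtain ⟨W, hW, hWΓ⟩ := OBM.exists_posDef_sqrt hΓ
  refine ⟨OBM.exists_isStandardBMVector n, OBM.exists_isHermitianGaussianMeasure n, W, hW,
    fun Ω₁ _ Q _ B hB => ?_, fun Ω₂ _ Q _ Z hZ => ?_⟩
  · refine OBM.eqLaw_of_coord (OBM.isGaussianProcess_coord hX.gaussian)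
      (hB.isGaussianProcess_mulVec W) (fun t i => ?_) fun s t i j => ?_
    · rw [hX.integral_eval, hB.integral_mulVec]
    · rw [hX.covariance_eval, hB.covariance_mulVec, hWΓ]
  · refine OBM.eqLaw_spectral (hZ.isGaussianRandomMeasure.matMeasure W)
      (OBM.isGaussianProcess_coord hX.gaussian) hX.integral_eval fun s t i j => ?_
    rw [hX.covariance_eval, hWΓ]
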